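/- Let $k$ be a field. A left bialgebroid over $k$ consists of unital $k$-algebras $A$, $U$, algebra maps $s:A\to U$, $t:A^{op}\to U$ with commuting images, and an $A$-coring structure $\Delta:U\to U_\triangleleft\otimes_A{}_\triangleright U$, $\epsilon:U\to A$ for the bimodule structure $a\triangleright u\triangleleft b=s(a)t(b)u$, such that $\Delta$ is a unital algebra map into the Takeuchi product $\{\sum u_i\otimes u_i' : \sum u_it(a)\otimes u_i'=\sum u_i\otimes u_i's(a)\ \forall a\in A\}$ and $\epsilon(us(\epsilon(v)))=\epsilon(uv)=\epsilon(ut(\epsilon(v)))$. A Hopf algebroid $\mathcal U=(U,A,s,t,\Delta,\epsilon,S)$ is a left bialgebroid with an involutive anti-automorphism $S$ of the algebra $U$ such that $S\circ t=s$, $S(u_{(1)})_{(1)}u_{(2)}\otimes S(u_{(1)})_{(2)}=1\otimes S(u)$ and $S(u_{(2)})_{(1)}\otimes S(u_{(2)})_{(2)}u_{(1)}=S(u)\otimes 1$. Then the map $\beta:U\otimes_{A^{op}}U\to U\otimes_AU$, $u\otimes v\mapsto u_{(1)}\otimes u_{(2)}v$ (with $ut(a)\otimes v=u\otimes t(a)v$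 in the source) is bijective, and one writes $u_+\otimes u_-:=\beta^{-1}(u\otimes 1)$. A stable anti-Yetter-Drinfeld (SAYD) module $P$ over $\mathcal U$ is a right $U$-module which is also a left $\mathcal U$-comodule, with (left $A$-linear, coassociative, counital) coaction $\Delta_P:P\to U_\triangleleft\otimes_AP$, $p\mapsto p_{(-1)}\otimes p_{(0)}$, such that $p\,s(a)t(b)=b\,\epsilon(p_{(-1)}s(a))\,p_{(0)}$, $\Delta_P(pu)=u_-p_{(-1)}u_{+(1)}\otimes p_{(0)}u_{+(2)}$ and $p_{(0)}p_{(-1)}=p$ for $p\in P$, $u\in U$, $a,b\in A$; here the right-hand side of the second condition is evaluated by means of $u_{+(1)}\otimes u_{+(2)}\otimes u_-=u_{(1)}\otimes u_{(2)+}\otimes u_{(2)-}$. The cocyclic module $C^\bullet(\mathcal U;P)$ of Kowalzig and Krähmer is $C^n(\mathcal U;P)=U^{\otimes_An}\otimes_AP$ with $$\delta_i(u^1\otimes\dots\otimes u^n\otimes p)=\begin{cases}1\otimes u^1\otimes\dots\otimes u^n\otimes p& i=0\\ u^1\otimes\dots\otimes\Delta(u^i)\otimes\dots\otimes u^n\otimes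 p&1\le i\le n\\ u^1\otimes\dots\otimes u^n\otimes p_{(-1)}\otimes p_{(0)}&i=n+1,\end{cases}$$ $\sigma_i(u^1\otimes\dots\otimes u^n\otimes p)=u^1\otimes\dots\otimes\epsilon(u^{i+1})\otimes\dots\otimes u^n\otimes p$ for $0\le i\le n-1$ ($\epsilon(u^{i+1})$ acting on the next factor), and $$\tau_n(u^1\otimes\dots\otimes u^n\otimes p)=u^1_{-(1)}u^2\otimes\dots\otimes u^1_{-(n-1)}u^n\otimes u^1_{-(n)}p_{(-1)}\otimes p_{(0)}u^1_+\quad(n\ge1),\qquad\tau_0=\mathrm{id}.$$ $HH^\bullet(\mathcal U;P)$ is the cohomology of $(C^\bullet(\mathcal U;P),b=\sum_i(-1)^i\delta_i)$, and $HC^\bullet(\mathcal U;P)$ is the cohomology of the total complex of the cyclic bicomplex (columns $b$, $-b'$; rows $1-\lambda$, $N$; $\lambda=(-1)^n\tau_n$). Let $\mathcal U$, $\mathcal U'$ be Hopf algebroids over $k$, and $C$ a cocommutative $k$-coalgebra. A $C$-measuring from $\mathcal U$ to $\mathcal U'$ is a pair of linear maps $\Psi:C\to\mathrm{Hom}_k(U,U')$,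 $\psi:C\to\mathrm{Hom}_k(A,A')$, both written $x\mapsto x(-)$, which are measurings of algebras ($x(ab)=x_{(1)}(a)x_{(2)}(b)$, $x(1)=\epsilon_C(x)1$), commute with $s,t,S,\epsilon$, and satisfy $\Delta'(x(u))=x_{(1)}(u_{(1)})\otimes x_{(2)}(u_{(2)})$. Let $P$, $P'$ be SAYD modules over $\mathcal U$, $\mathcal U'$, and let $D$ be a right $C$-comodule. A $(C,\Psi,\psi)$-comodule measuring from $P$ to $P'$ is a linear map $\Omega:D\to\mathrm{Hom}_k(P,P')$, written $y\mapsto y(-)$, with $y(pu)=y_{(0)}(p)\,y_{(1)}(u)$ and $\Delta_{P'}(y(p))=y_{(1)}(p_{(-1)})\otimes y_{(0)}(p_{(0)})$. **Proposition.** Let $(\Psi,\psi)$ be a $C$-measuring from $\mathcal U$ to $\mathcal U'$ with $C$ cocommutative, and let $\Omega:D\to\mathrm{Hom}_k(P,P')$ be a $(C,\Psi,\psi)$-comodule measuring of SAYD modules. Then, for each $y\in D$, the family of maps $$\overline\Omega^n(y):C^n(\mathcal U;P)\to C^n(\mathcal U';P'),\qquad u^1\otimes\dots\otimes u^n\otimes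 p\mapsto y_{(1)}(u^1)\otimes\dots\otimes y_{(n)}(u^n)\otimes y_{(0)}(p)\qquad(n\ge0)$$ is well defined and is a morphism of cocyclic modules, that is, it commutes with all $\delta_i$, $\sigma_i$ and $\tau_n$. In particular it induces linear maps $HH^\bullet(\mathcal U;P)\to HH^\bullet(\mathcal U';P')$ and $HC^\bullet(\mathcal U;P)\to HC^\bullet(\mathcal U';P')$. -/

import Mathlib

universe u v

noncomputable section

open TensorProduct MulOpposite

/-! ### Balanced tensor products over a noncommutative base -/

namespace HopfAlgd

section Balanced

variable {k : Type*} [Field k] {A : Type*}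
  {M : Type*} [AddCommGroup M] [Module k M] {N : Type*} [AddCommGroup N] [Module k N]
  {Q : Type*} [AddCommGroup Q] [Module k Q]

/-- The relations `(m ◁ a) ⊗ n = m ⊗ (a ▷ n)`. -/
def balRel (r : A → Module.End k M) (l : A → Module.End k N) : Submodule k (M ⊗[k] N) :=
  Submodule.span k {z | ∃ a m n, z = r a m ⊗ₜ[k] n - m ⊗ₜ[k] l a n}

/-- The balanced tensor product of `M` and `N`, where `A` acts on `M` from the right through `r`
and on `N` from the left through `l`: the quotient of `M ⊗ₖ N` by `(m ◁ a) ⊗ n = m ⊗ (a ▷ n)`. -/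
def Bal (r : A → Module.End k M) (l : A → Module.End k N) : Type _ :=
  (M ⊗[k] N) ⧸ balRel r l

instance (r : A → Module.End k M) (l : A → Module.End k N) : AddCommGroup (Bal r l) :=
  inferInstanceAs (AddCommGroup ((M ⊗[k] N) ⧸ balRel r l))

instance (r : A → Module.End k M) (l : A → Module.End k N) : Module k (Bal r l) :=
  inferInstanceAs (Module k ((M ⊗[k] N) ⧸ balRel r l))

namespace Bal

/-- The class of `m ⊗ n`. -/
def mk (r : A → Module.End k M) (l : A → Module.End k N) : M →ₗ[k] N →ₗ[k] Bal r l :=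
  (TensorProduct.mk k M N).compr₂ (balRel r l).mkQ

variable {r : A → Module.End k M} {l : A → Module.End k N}

theorem mk_bal (a : A) (m : M) (n : N) : mk r l (r a m) n = mk r l m (l a n) := by
  refine (Submodule.Quotient.eq (balRel r l)).2 (Submodule.subset_span ⟨a, m, n, rfl⟩)

/-- The universal property of the balanced tensor product. -/
def lift (f : M →ₗ[k] N →ₗ[k] Q) (h : ∀ a m n, f (r a m) n = f m (l a n)) : Bal r l →ₗ[k] Q :=
  (balRel r l).liftQ (TensorProduct.lift f) (by
    rw [balRel, Submodule.span_le]
    rintro _ ⟨a, m, n, rfl⟩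
    simp [h])

@[simp] theorem lift_mk (f : M →ₗ[k] N →ₗ[k] Q) (h : ∀ a m n, f (r a m) n = f m (l a n))
    (m : M) (n : N) : lift f h (mk r l m n) = f m n := by
  change (balRel r l).liftQ (TensorProduct.lift f) _ ((balRel r l).mkQ (m ⊗ₜ n)) = _
  simp

theorem hom_ext {f g : Bal r l →ₗ[k] Q} (h : ∀ m n, f (mk r l m n) = g (mk r l m n)) : f = g := by
  apply Submodule.linearMap_qext (p := balRel r l)
  apply TensorProduct.ext'
  exact h

theorem exists_sum (z : Bal r l) :
    ∃ (n : ℕ) (a : Fin n → M) (b : Fin n → N), z = ∑ i, mk r l (a i) (b i) := by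
  obtain ⟨x, rfl⟩ := (balRel r l).mkQ_surjective z
  obtain ⟨S, rfl⟩ := TensorProduct.exists_finset (R := k) x
  refine ⟨S.card, fun i => (S.equivFin.symm i).1.1, fun i => (S.equivFin.symm i).1.2, ?_⟩
  rw [map_sum, ← Finset.sum_coe_sort]
  exact (S.equivFin.symm.sum_comp
    (fun j : S => (balRel r l).mkQ (j.1.1 ⊗ₜ[k] j.1.2))).symm

theorem ind {p : Bal r l → Prop} (h0 : p 0) (h : ∀ m n, p (mk r l m n))
    (ha : ∀ x y, p x → p y → p (x + y)) (z : Bal r l) : p z := by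
  obtain ⟨n, a, b, rfl⟩ := exists_sum z
  exact Finset.sum_induction _ p ha h0 fun i _ => h _ _

end Bal

end Balanced

/-! ### Left modules over a `k`-algebra, bundled -/

/-- A `k`-linear left module over a `k`-algebra `R`. -/
structure LMod (k : Type*) (R : Type*) [Field k] [Ring R] [Algebra k R] where
  carrier : Type u
  [grp : AddCommGroup carrier]
  [mod : Module k carrier]
  act : R →ₐ[k] Module.End k carrier

attribute [instance] LMod.grp LMod.mod

namespace LMod

section

variable {k : Type*} {R : Type*} [Field k] [Ring R] [Algebra k R]

/-- A left `R`-module in the sense of Mathlib, bundled. -/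
abbrev of (k R : Type*) [Field k] [Ring R] [Algebra k R] (M : Type u) [AddCommGroup M] [Module k M]
    [Module R M] [IsScalarTower k R M] : LMod.{u} k R where
  carrier := M
  act := Algebra.lsmul k k M

/-- Restriction of scalars along an algebra map. -/
abbrev restrict {R' : Type*} [Ring R'] [Algebra k R'] (f : R' →ₐ[k] R) (M : LMod.{u} k R) :
    LMod.{u} k R' where
  carrier := M.carrier
  act := M.act.comp f

/-- Morphisms of left `R`-modules. -/
structure Hom (M : LMod.{u} k R) (N : LMod.{v} k R) where
  toLin : M.carrier →ₗ[k] N.carrier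
  map_act : ∀ a m, toLin (M.act a m) = N.act a (toLin m)

end

end LMod

/-! ### Left bialgebroids and Hopf algebroids -/

/-- An `(s,t)`-ring `U` over `A`. -/
structure STRing (k A U : Type*) [Field k] [Ring A] [Algebra k A] [Ring U] [Algebra k U] where
  s : A →ₐ[k] U
  t : Aᵐᵒᵖ →ₐ[k] U
  s_mul_t : ∀ a b, s a * t b = t b * s a

namespace STRing

variable {k A : Type*} {U : Type u} [Field k] [Ring A] [Algebra k A] [Ring U] [Algebra k U]
  (H : STRing k A U)

/-- `v ⊗ n ↦ s(a) v ⊗ n`. -/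
def tensAct (V : LMod.{u} k U) (N : LMod.{u} k A) (a : A) :
    Module.End k (Bal (fun a => V.act (H.t (op a))) (fun a => N.act a)) :=
  Bal.lift ((Bal.mk (fun a => V.act (H.t (op a))) (fun a => N.act a)).comp (V.act (H.s a)))
    (fun b m n => by
      simp only [LinearMap.comp_apply]
      rw [← Bal.mk_bal, ← Module.End.mul_apply, ← Module.End.mul_apply, ← map_mul, ← map_mul,
        H.s_mul_t])

@[simp] theorem tensAct_mk (V : LMod.{u} k U) (N : LMod.{u} k A) (a : A) (v : V.carrier)
    (n : N.carrier) :
    H.tensAct V N a (Bal.mk (fun a => V.act (H.t (op a))) (fun a => N.act a) v n) =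
      Bal.mk (fun a => V.act (H.t (op a))) (fun a => N.act a) (V.act (H.s a) v) n := by
  simp [tensAct]

/-- For a left `U`-module `V` and a left `A`-module `N`, the tensor product `V ⊗_A N` formed with
respect to the right `A`-action `v ◁ a = t(a) v` on `V`; it is a left `A`-module through
`a ▷ (v ⊗ n) = s(a) v ⊗ n`. -/
def tens (V : LMod.{u} k U) (N : LMod.{u} k A) : LMod.{u} k A where
  carrier := Bal (fun a => V.act (H.t (op a))) (fun a => N.act a)
  act := AlgHom.ofLinearMap
    { toFun := H.tensAct V N
      map_add' := fun a b => Bal.hom_ext fun m n => by simp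
      map_smul' := fun c a => Bal.hom_ext fun m n => by simp }
    (Bal.hom_ext fun m n => by simp)
    (fun a b => Bal.hom_ext fun m n => by simp)

/-- The class of `v ⊗ n` in `V ⊗_A N`. -/
def tm (V : LMod.{u} k U) (N : LMod.{u} k A) :
    V.carrier →ₗ[k] N.carrier →ₗ[k] (H.tens V N).carrier :=
  Bal.mk _ _

theorem tm_bal {V : LMod.{u} k U} {N : LMod.{u} k A} (a : A) (v : V.carrier) (n : N.carrier) :
    H.tm V N (V.act (H.t (op a)) v) n = H.tm V N v (N.act a n) :=
  Bal.mk_bal (r := fun a => V.act (H.t (op a))) (l := fun a => N.act a) a v n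

theorem act_tm {V : LMod.{u} k U} {N : LMod.{u} k A} (a : A) (v : V.carrier) (n : N.carrier) :
    (H.tens V N).act a (H.tm V N v n) = H.tm V N (V.act (H.s a) v) n :=
  H.tensAct_mk V N a v n

/-- The universal property of `V ⊗_A N`. -/
def lift {Q : Type*} [AddCommGroup Q] [Module k Q] {V : LMod.{u} k U} {N : LMod.{u} k A}
    (f : V.carrier →ₗ[k] N.carrier →ₗ[k] Q)
    (h : ∀ a v n, f (V.act (H.t (op a)) v) n = f v (N.act a n)) :
    (H.tens V N).carrier →ₗ[k] Q :=
  Bal.lift f h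

@[simp] theorem lift_tm {Q : Type*} [AddCommGroup Q] [Module k Q] {V : LMod.{u} k U}
    {N : LMod.{u} k A} (f : V.carrier →ₗ[k] N.carrier →ₗ[k] Q)
    (h : ∀ a v n, f (V.act (H.t (op a)) v) n = f v (N.act a n)) (v : V.carrier) (n : N.carrier) :
    H.lift f h (H.tm V N v n) = f v n :=
  Bal.lift_mk f h v n

theorem hom_ext {Q : Type*} [AddCommGroup Q] [Module k Q] {V : LMod.{u} k U} {N : LMod.{u} k A}
    {f g : (H.tens V N).carrier →ₗ[k] Q}
    (h : ∀ v n, f (H.tm V N v n) = g (H.tm V N v n)) : f = g :=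
  Bal.hom_ext h

/-- `U` as a left module over itself. -/
abbrev reg (_ : STRing k A U) : LMod.{u} k U := LMod.of k U U

/-- A left `U`-module viewed as a left `A`-module through the source map. -/
abbrev src (V : LMod.{u} k U) : LMod.{u} k A := V.restrict H.s

/-- `U_◁ ⊗_A N` for a left `A`-module `N`, where `u ◁ a = t(a) u`. -/
abbrev ten (N : LMod.{u} k A) : LMod.{u} k A := H.tens H.reg N

/-- The class of `u ⊗ n` in `U_◁ ⊗_A N`. -/
def ut (N : LMod.{u} k A) : U →ₗ[k] N.carrier →ₗ[k] (H.ten N).carrier := H.tm H.reg N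

section

variable {N : LMod.{u} k A} {Q : Type*} [AddCommGroup Q] [Module k Q]

theorem ut_bal (a : A) (u : U) (n : N.carrier) :
    H.ut N (H.t (op a) * u) n = H.ut N u (N.act a n) :=
  H.tm_bal (V := H.reg) a u n

theorem act_ut (a : A) (u : U) (n : N.carrier) :
    (H.ten N).act a (H.ut N u n) = H.ut N (H.s a * u) n :=
  H.act_tm (V := H.reg) a u n

/-- The universal property of `U_◁ ⊗_A N`. -/
def liftU (f : U →ₗ[k] N.carrier →ₗ[k] Q) (h : ∀ a u n, f (H.t (op a) * u) n = f u (N.act a n)) :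
    (H.ten N).carrier →ₗ[k] Q :=
  H.lift (V := H.reg) f h

@[simp] theorem liftU_ut (f : U →ₗ[k] N.carrier →ₗ[k] Q)
    (h : ∀ a u n, f (H.t (op a) * u) n = f u (N.act a n)) (u : U) (n : N.carrier) :
    H.liftU f h (H.ut N u n) = f u n :=
  H.lift_tm (V := H.reg) f h u n

theorem ut_ext {f g : (H.ten N).carrier →ₗ[k] Q} (h : ∀ u n, f (H.ut N u n) = g (H.ut N u n)) :
    f = g :=
  H.hom_ext (V := H.reg) h

theorem ut_exists_sum (z : (H.ten N).carrier) :
    ∃ (n : ℕ) (a : Fin n → U) (b : Fin n → N.carrier), z = ∑ i, H.ut N (a i) (b i) :=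
  Bal.exists_sum z

end

/-- `U_◁ ⊗_A ▷U`, where `a ▷ u ◁ b = s(a) t(b) u`. -/
abbrev UU : LMod.{u} k A := H.ten (H.src H.reg)

/-- The class of `u ⊗ v` in `U_◁ ⊗_A ▷U`. -/
def tmul : U →ₗ[k] U →ₗ[k] H.UU.carrier := H.ut (H.src H.reg)

theorem tmul_bal (a : A) (u v : U) : H.tmul (H.t (op a) * u) v = H.tmul u (H.s a * v) :=
  H.ut_bal (N := H.src H.reg) a u v

/-- The universal property of `U_◁ ⊗_A ▷U`. -/
def liftUU {Q : Type*} [AddCommGroup Q] [Module k Q] (f : U →ₗ[k] U →ₗ[k] Q)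
    (h : ∀ a u v, f (H.t (op a) * u) v = f u (H.s a * v)) : H.UU.carrier →ₗ[k] Q :=
  H.liftU (N := H.src H.reg) f h

@[simp] theorem liftUU_tmul {Q : Type*} [AddCommGroup Q] [Module k Q] (f : U →ₗ[k] U →ₗ[k] Q)
    (h : ∀ a u v, f (H.t (op a) * u) v = f u (H.s a * v)) (u v : U) :
    H.liftUU f h (H.tmul u v) = f u v :=
  H.liftU_ut (N := H.src H.reg) f h u v

theorem tmul_ext {Q : Type*} [AddCommGroup Q] [Module k Q] {f g : H.UU.carrier →ₗ[k] Q}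
    (h : ∀ u v, f (H.tmul u v) = g (H.tmul u v)) : f = g :=
  H.ut_ext (N := H.src H.reg) h

theorem tmul_exists_sum (z : H.UU.carrier) :
    ∃ (n : ℕ) (a b : Fin n → U), z = ∑ i, H.tmul (a i) (b i) :=
  H.ut_exists_sum (N := H.src H.reg) z

/-- `x ⊗ y ↦ x v ⊗ y w` on `U_◁ ⊗_A ▷U`. -/
def mulRight (v w : U) : H.UU.carrier →ₗ[k] H.UU.carrier :=
  H.liftUU (H.tmul.compl₁₂ (LinearMap.mulRight k v) (LinearMap.mulRight k w)) (fun a x y => by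
    simp [mul_assoc, tmul_bal])

@[simp] theorem mulRight_tmul (v w x y : U) :
    H.mulRight v w (H.tmul x y) = H.tmul (x * v) (y * w) := by
  simp [mulRight]

/-- `(x ⊗ y, n) ↦ x ⊗ (y ⊗ n)`, as a map from `(U ⊗_A U) × N` to `U ⊗_A (U ⊗_A N)`. -/
def assoc (N : LMod.{u} k A) :
    H.UU.carrier →ₗ[k] N.carrier →ₗ[k] (H.ten (H.ten N)).carrier :=
  H.liftUU
    (LinearMap.mk₂ k (fun x y => (H.ut (H.ten N) x).comp (H.ut N y))
      (fun x x' y => by ext n; simp) (fun c x y => by ext n; simp)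
      (fun x y y' => by ext n; simp) (fun c x y => by ext n; simp))
    (fun a x y => by ext n; simp [ut_bal, act_ut])

@[simp] theorem assoc_tmul (N : LMod.{u} k A) (x y : U) (n : N.carrier) :
    H.assoc N (H.tmul x y) n = H.ut (H.ten N) x (H.ut N y n) := by
  simp [assoc]

end STRing

/-- A left bialgebroid: an `(s,t)`-ring `U` over `A` together with an `A`-coring structure `(Δ, ε)`
on the bimodule `a ▷ u ◁ b = s(a) t(b) u` such that `Δ` is a unital algebra map into the Takeuchi
product and `ε` satisfies the usual compatibility with the product of `U`. Whenever a formula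
contains `u₍₁₎ ⊗ u₍₂₎`, it is stated for every expression `Δ u = ∑ i, x i ⊗ y i`. -/
structure LeftBialgebroid (k A : Type*) (U : Type u) [Field k] [Ring A] [Algebra k A] [Ring U]
    [Algebra k U] extends STRing k A U where
  Δ : U →ₗ[k] toSTRing.UU.carrier
  ε : U →ₗ[k] A
  /-- `Δ (s(a) t(b) u) = s(a) u₍₁₎ ⊗ t(b) u₍₂₎` -/
  Δ_bimod : ∀ (a b : A) (u : U) (n : ℕ) (x y : Fin n → U),
    Δ u = ∑ i, toSTRing.tmul (x i) (y i) →
      Δ (s a * t (op b) * u) = ∑ i, toSTRing.tmul (s a * x i) (t (op b) * y i)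
  ε_bimod : ∀ (a b : A) (u : U), ε (s a * t (op b) * u) = a * ε u * b
  /-- `Δ u₍₁₎ ⊗ u₍₂₎ = u₍₁₎ ⊗ Δ u₍₂₎` -/
  coassoc : ∀ (u : U) (n : ℕ) (x y : Fin n → U), Δ u = ∑ i, toSTRing.tmul (x i) (y i) →
    ∑ i, toSTRing.assoc (toSTRing.src toSTRing.reg) (Δ (x i)) (y i) =
      ∑ i, toSTRing.ut toSTRing.UU (x i) (Δ (y i))
  counit_left : ∀ (u : U) (n : ℕ) (x y : Fin n → U), Δ u = ∑ i, toSTRing.tmul (x i) (y i) →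
    ∑ i, s (ε (x i)) * y i = u
  counit_right : ∀ (u : U) (n : ℕ) (x y : Fin n → U), Δ u = ∑ i, toSTRing.tmul (x i) (y i) →
    ∑ i, t (op (ε (y i))) * x i = u
  /-- `Δ` takes values in the Takeuchi product. -/
  takeuchi : ∀ (a : A) (u : U),
    toSTRing.mulRight (t (op a)) 1 (Δ u) = toSTRing.mulRight 1 (s a) (Δ u)
  Δ_one : Δ 1 = toSTRing.tmul 1 1
  /-- `Δ (u v) = u₍₁₎ v₍₁₎ ⊗ u₍₂₎ v₍₂₎` -/
  Δ_mul : ∀ (u v : U) (n : ℕ) (x y : Fin n → U), Δ v = ∑ i, toSTRing.tmul (x i) (y i) →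
    Δ (u * v) = ∑ i, toSTRing.mulRight (x i) (y i) (Δ u)
  ε_mul_s : ∀ u v, ε (u * s (ε v)) = ε (u * v)
  ε_mul_t : ∀ u v, ε (u * t (op (ε v))) = ε (u * v)

/-- A Hopf algebroid: a left bialgebroid with an involutive anti-automorphism `S` of the algebra
`U` satisfying `S t = s` and the two antipode identities. -/
structure HopfAlgebroid (k A : Type*) (U : Type u) [Field k] [Ring A] [Algebra k A] [Ring U]
    [Algebra k U] extends LeftBialgebroid k A U where
  S : U →ₗ[k] U
  S_one : S 1 = 1
  S_mul : ∀ u v, S (u * v) = S v * S u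
  S_S : ∀ u, S (S u) = u
  S_t : ∀ a, S (t (op a)) = s a
  /-- `S(u₍₁₎)₍₁₎ u₍₂₎ ⊗ S(u₍₁₎)₍₂₎ = 1 ⊗ S(u)` -/
  antipode_left : ∀ (u : U) (n : ℕ) (x y : Fin n → U), Δ u = ∑ i, toSTRing.tmul (x i) (y i) →
    ∑ i, toSTRing.mulRight (y i) 1 (Δ (S (x i))) = toSTRing.tmul 1 (S u)
  /-- `S(u₍₂₎)₍₁₎ ⊗ S(u₍₂₎)₍₂₎ u₍₁₎ = S(u) ⊗ 1` -/
  antipode_right : ∀ (u : U) (n : ℕ) (x y : Fin n → U), Δ u = ∑ i, toSTRing.tmul (x i) (y i) →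
    ∑ i, toSTRing.mulRight 1 (x i) (Δ (S (y i))) = toSTRing.tmul (S u) 1

namespace HopfAlgebroid

variable {k A : Type*} {U : Type u} [Field k] [Ring A] [Algebra k A] [Ring U] [Algebra k U]
  (H : HopfAlgebroid k A U)

/-- `▶U ⊗_{A^op} U_◁`: the quotient of `U ⊗ₖ U` by `u t(a) ⊗ v = u ⊗ t(a) v`. -/
abbrev UopU : Type u :=
  Bal (fun a : A => LinearMap.mulRight k (H.t (op a))) (fun a : A => LinearMap.mulLeft k (H.t (op a)))

/-- The class of `u ⊗ v` in `▶U ⊗_{A^op} U_◁`. -/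
def omul : U →ₗ[k] U →ₗ[k] H.UopU := Bal.mk _ _

theorem omul_bal (a : A) (u v : U) : H.omul (u * H.t (op a)) v = H.omul u (H.t (op a) * v) :=
  Bal.mk_bal (r := fun a : A => LinearMap.mulRight k (H.t (op a)))
    (l := fun a : A => LinearMap.mulLeft k (H.t (op a))) a u v

/-- The universal property of `▶U ⊗_{A^op} U_◁`. -/
def liftOp {Q : Type*} [AddCommGroup Q] [Module k Q] (f : U →ₗ[k] U →ₗ[k] Q)
    (h : ∀ a u v, f (u * H.t (op a)) v = f u (H.t (op a) * v)) : H.UopU →ₗ[k] Q :=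
  Bal.lift f h

@[simp] theorem liftOp_omul {Q : Type*} [AddCommGroup Q] [Module k Q] (f : U →ₗ[k] U →ₗ[k] Q)
    (h : ∀ a u v, f (u * H.t (op a)) v = f u (H.t (op a) * v)) (u v : U) :
    H.liftOp f h (H.omul u v) = f u v :=
  Bal.lift_mk f h u v

theorem omul_ext {Q : Type*} [AddCommGroup Q] [Module k Q] {f g : H.UopU →ₗ[k] Q}
    (h : ∀ u v, f (H.omul u v) = g (H.omul u v)) : f = g :=
  Bal.hom_ext h

theorem S_s (a : A) : H.S (H.s a) = H.t (op a) := by rw [← H.S_t, H.S_S]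

theorem Δ_t_mul (a : A) (u : U) (n : ℕ) (x y : Fin n → U)
    (h : H.Δ u = ∑ i, H.tmul (x i) (y i)) :
    H.Δ (H.t (op a) * u) = ∑ i, H.tmul (x i) (H.t (op a) * y i) := by
  simpa using H.Δ_bimod 1 a u n x y h

theorem Δ_s_mul (a : A) (u : U) (n : ℕ) (x y : Fin n → U)
    (h : H.Δ u = ∑ i, H.tmul (x i) (y i)) :
    H.Δ (H.s a * u) = ∑ i, H.tmul (H.s a * x i) (y i) := by
  simpa using H.Δ_bimod a 1 u n x y h

theorem Δ_mul_t (a : A) (u : U) : H.Δ (u * H.t (op a)) = H.mulRight 1 (H.t (op a)) (H.Δ u) := by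
  have h1 : H.Δ (H.t (op a)) = ∑ i : Fin 1, H.tmul ((fun _ => 1) i) ((fun _ => H.t (op a)) i) := by
    have := H.Δ_t_mul a 1 1 (fun _ => 1) (fun _ => 1) (by simp [H.Δ_one])
    simpa using this
  simpa using H.Δ_mul u _ 1 _ _ h1

theorem Δ_mul_s (a : A) (u : U) : H.Δ (u * H.s a) = H.mulRight (H.s a) 1 (H.Δ u) := by
  have h1 : H.Δ (H.s a) = ∑ i : Fin 1, H.tmul ((fun _ => H.s a) i) ((fun _ => 1) i) := by
    have := H.Δ_s_mul a 1 1 (fun _ => 1) (fun _ => 1) (by simp [H.Δ_one])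
    simpa using this
  simpa using H.Δ_mul u _ 1 _ _ h1

theorem mulRight_mulRight (v w v' w' : U) (z : H.UU.carrier) :
    H.mulRight v w (H.mulRight v' w' z) = H.mulRight (v' * v) (w' * w) z := by
  refine LinearMap.congr_fun (f := (H.mulRight v w).comp (H.mulRight v' w')) ?_ z
  exact H.tmul_ext fun x y => by simp [mul_assoc]

/-- `(v, w) ↦ (x ⊗ y ↦ x v ⊗ y w)` is bilinear. -/
def mulRightHom : U →ₗ[k] U →ₗ[k] Module.End k H.UU.carrier :=
  LinearMap.mk₂ k (fun v w => H.mulRight v w)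
    (fun v v' w => H.tmul_ext fun x y => by simp [mul_add])
    (fun c v w => H.tmul_ext fun x y => by simp)
    (fun v w w' => H.tmul_ext fun x y => by simp [mul_add])
    (fun c v w => H.tmul_ext fun x y => by simp)

@[simp] theorem mulRightHom_apply (v w : U) : H.mulRightHom v w = H.mulRight v w := rfl

/-- The Hopf-Galois map `β : ▶U ⊗_{A^op} U_◁ → U_◁ ⊗_A ▷U`, `u ⊗ v ↦ u₍₁₎ ⊗ u₍₂₎ v`. -/
def galois : H.UopU →ₗ[k] H.UU.carrier :=
  H.liftOp (LinearMap.mk₂ k (fun u v => H.mulRight 1 v (H.Δ u))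
      (fun u u' v => by simp) (fun c u v => by simp)
      (fun u v v' => by rw [← mulRightHom_apply, map_add]; rfl)
      (fun c u v => by rw [← mulRightHom_apply, map_smul]; rfl))
    (fun a u v => by
      simp [Δ_mul_t, mulRight_mulRight])

theorem galois_omul (u v : U) : H.galois (H.omul u v) = H.mulRight 1 v (H.Δ u) :=
  H.liftOp_omul _ _ u v

/-- `x ⊗ y ↦ S(y) ⊗ x v`. -/
def galoisAux (v : U) : H.UU.carrier →ₗ[k] H.UopU :=
  H.liftUU (LinearMap.mk₂ k (fun x y => H.omul (H.S y) (x * v))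
      (fun u u' v => by simp [add_mul]) (fun c u v => by simp)
      (fun u v v' => by simp) (fun c u v => by simp))
    (fun a x y => by simp [H.S_mul, H.S_s, omul_bal, mul_assoc])

@[simp] theorem galoisAux_tmul (v x y : U) :
    H.galoisAux v (H.tmul x y) = H.omul (H.S y) (x * v) := by
  simp [galoisAux]

theorem galoisAux_mulRight (v w : U) (z : H.UU.carrier) :
    H.galoisAux v (H.mulRight w 1 z) = H.galoisAux (w * v) z := by
  refine LinearMap.congr_fun (f := (H.galoisAux v).comp (H.mulRight w 1)) ?_ z
  exact H.tmul_ext fun x y => by simp [mul_assoc]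

theorem galois_galoisAux (u v : U) : H.galois (H.galoisAux v (H.Δ (H.S u))) = H.tmul u v := by
  obtain ⟨n, x, y, h⟩ := H.tmul_exists_sum (H.Δ (H.S u))
  have := congrArg (H.mulRight 1 v) (H.antipode_right _ n x y h)
  simp only [map_sum, mulRight_mulRight, one_mul, H.S_S, STRing.mulRight_tmul, mul_one] at this
  simp only [h, map_sum, galoisAux_tmul, galois_omul]
  exact this

theorem galois_bijective : Function.Bijective H.galois := by
  -- the candidate inverse is `u ⊗ v ↦ S(S(u)₍₂₎) ⊗ S(u)₍₁₎ v`
  let g : H.UU.carrier →ₗ[k] H.UopU :=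
    H.liftUU (LinearMap.mk₂ k (fun u v => H.galoisAux v (H.Δ (H.S u)))
      (fun u u' v => by simp) (fun c u v => by simp)
      (fun u v v' => by
        obtain ⟨n, x, y, h⟩ := H.tmul_exists_sum (H.Δ (H.S u))
        simp [h, mul_add, Finset.sum_add_distrib])
      (fun c u v => by
        obtain ⟨n, x, y, h⟩ := H.tmul_exists_sum (H.Δ (H.S u))
        simp [h, Finset.smul_sum]))
    (fun a u v => by
      simp [H.S_mul, H.S_t, Δ_mul_s, galoisAux_mulRight])
  have hg : ∀ u v, g (H.tmul u v) = H.galoisAux v (H.Δ (H.S u)) := fun u v => H.liftUU_tmul _ _ u v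
  have h1 : g.comp H.galois = LinearMap.id := by
    refine H.omul_ext fun u v => ?_
    obtain ⟨n, x, y, h⟩ := H.tmul_exists_sum (H.Δ u)
    have := congrArg (H.galoisAux v) (H.antipode_left _ n x y h)
    simp only [map_sum, galoisAux_mulRight, galoisAux_tmul, H.S_S, one_mul] at this
    simpa [galois_omul, h, hg] using this
  have h2 : H.galois.comp g = LinearMap.id := by
    refine H.tmul_ext fun u v => ?_
    simp [hg, galois_galoisAux]
  exact ⟨Function.LeftInverse.injective (g := g) (LinearMap.congr_fun h1),
    Function.RightInverse.surjective (g := g) (LinearMap.congr_fun h2)⟩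

/-- The translation map `u ↦ u₊ ⊗ u₋ = β⁻¹(u ⊗ 1)`. -/
def transl : U →ₗ[k] H.UopU :=
  (LinearEquiv.ofBijective H.galois H.galois_bijective).symm.toLinearMap.comp (H.tmul.flip 1)

theorem galois_transl (u : U) : H.galois (H.transl u) = H.tmul u 1 :=
  (LinearEquiv.ofBijective H.galois H.galois_bijective).apply_symm_apply _

/-- `w ⊗ v ↦ w ⊗ v b` on `▶U ⊗_{A^op} U_◁`. -/
def oRight (b : U) : Module.End k H.UopU :=
  H.liftOp (H.omul.compl₂ (LinearMap.mulRight k b)) (fun a u v => by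
    simp [omul_bal, mul_assoc])

@[simp] theorem oRight_omul (b u v : U) : H.oRight b (H.omul u v) = H.omul u (v * b) :=
  H.liftOp_omul _ _ u v

/-- `w ⊗ v ↦ b w ⊗ v` on `▶U ⊗_{A^op} U_◁`. -/
def oLeft (b : U) : Module.End k H.UopU :=
  H.liftOp (H.omul.compl₁₂ (LinearMap.mulLeft k b) LinearMap.id) (fun a u v => by
    simp [← mul_assoc, omul_bal])

@[simp] theorem oLeft_omul (b u v : U) : H.oLeft b (H.omul u v) = H.omul (b * u) v :=
  H.liftOp_omul _ _ u v

theorem galois_oRight (b : U) (z : H.UopU) :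
    H.galois (H.oRight b z) = H.mulRight 1 b (H.galois z) := by
  refine LinearMap.congr_fun (f := H.galois.comp (H.oRight b))
    (g := (H.mulRight 1 b).comp H.galois) (H.omul_ext fun u v => ?_) z
  simp [galois_omul, mulRight_mulRight]

/-- `x ⊗ y ↦ x ⊗ t(a) y` on `U_◁ ⊗_A ▷U`. -/
def tLeft (a : A) : Module.End k H.UU.carrier :=
  H.liftUU (H.tmul.compl₂ (LinearMap.mulLeft k (H.t (op a)))) (fun b u v => by
    simp only [LinearMap.compl₂_apply, LinearMap.mulLeft_apply, STRing.tmul_bal]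
    rw [← mul_assoc, H.s_mul_t, mul_assoc])

@[simp] theorem tLeft_tmul (a : A) (x y : U) :
    H.tLeft a (H.tmul x y) = H.tmul x (H.t (op a) * y) :=
  H.liftUU_tmul _ _ x y

theorem galois_oLeft (a : A) (z : H.UopU) :
    H.galois (H.oLeft (H.t (op a)) z) = H.tLeft a (H.galois z) := by
  refine LinearMap.congr_fun (f := H.galois.comp (H.oLeft (H.t (op a))))
    (g := (H.tLeft a).comp H.galois) (H.omul_ext fun u v => ?_) z
  obtain ⟨n, x, y, h⟩ := H.tmul_exists_sum (H.Δ u)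
  simp [galois_omul, H.Δ_t_mul a u n x y h, h, mul_assoc]

/-- `t(a) u₊ ⊗ u₋ = u₊ ⊗ u₋ t(a)` -/
theorem transl_t (a : A) (u : U) :
    H.oLeft (H.t (op a)) (H.transl u) = H.oRight (H.t (op a)) (H.transl u) := by
  apply H.galois_bijective.1
  simp [galois_oLeft, galois_oRight, galois_transl]

/-- `(t(a) u)₊ ⊗ (t(a) u)₋ = u₊ ⊗ u₋ s(a)` -/
theorem transl_t_mul (a : A) (u : U) :
    H.transl (H.t (op a) * u) = H.oRight (H.s a) (H.transl u) := by
  apply H.galois_bijective.1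
  simp [galois_oRight, galois_transl, STRing.tmul_bal]

/-! #### The diagonal action on tensor powers -/

/-- The tensor product `U_◁ ⊗_A V` for a left `U`-module `V`, on which `A` acts through `s`. -/
def UV (V : LMod.{u} k U) : Type u :=
  Bal (fun a : A => LinearMap.mulLeft k (H.t (op a))) (fun a : A => V.act (H.s a))

instance (V : LMod.{u} k U) : AddCommGroup (H.UV V) :=
  inferInstanceAs (AddCommGroup (Bal (fun a : A => LinearMap.mulLeft k (H.t (op a)))
    (fun a : A => V.act (H.s a))))

instance (V : LMod.{u} k U) : Module k (H.UV V) :=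
  inferInstanceAs (Module k (Bal (fun a : A => LinearMap.mulLeft k (H.t (op a)))
    (fun a : A => V.act (H.s a))))

section

variable {V : LMod.{u} k U} {Q : Type*} [AddCommGroup Q] [Module k Q]

/-- The class of `u ⊗ v` in `U_◁ ⊗_A V`. -/
def uv (V : LMod.{u} k U) : U →ₗ[k] V.carrier →ₗ[k] H.UV V := Bal.mk _ _

theorem uv_bal (a : A) (u : U) (v : V.carrier) :
    H.uv V (H.t (op a) * u) v = H.uv V u (V.act (H.s a) v) :=
  Bal.mk_bal (r := fun a : A => LinearMap.mulLeft k (H.t (op a)))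
    (l := fun a : A => V.act (H.s a)) a u v

/-- The universal property of `U_◁ ⊗_A V`. -/
def liftUV (f : U →ₗ[k] V.carrier →ₗ[k] Q)
    (h : ∀ a u v, f (H.t (op a) * u) v = f u (V.act (H.s a) v)) : H.UV V →ₗ[k] Q :=
  Bal.lift f h

@[simp] theorem liftUV_uv (f : U →ₗ[k] V.carrier →ₗ[k] Q)
    (h : ∀ a u v, f (H.t (op a) * u) v = f u (V.act (H.s a) v)) (u : U) (v : V.carrier) :
    H.liftUV f h (H.uv V u v) = f u v :=
  Bal.lift_mk f h u v

theorem uv_ext {f g : H.UV V →ₗ[k] Q} (h : ∀ u v, f (H.uv V u v) = g (H.uv V u v)) : f = g :=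
  Bal.hom_ext h

end

/-- For `x ∈ U` and `y ∈ V`, the map `u ⊗ v ↦ u x ⊗ v y`. -/
def diagMap (V : LMod.{u} k U) (x : U) (y : V.carrier) : H.UU.carrier →ₗ[k] H.UV V :=
  H.liftUU ((H.uv V).compl₁₂ (LinearMap.mulRight k x) (V.act.toLinearMap.flip y))
    (fun a u v => by simp [mul_assoc, uv_bal])

@[simp] theorem diagMap_tmul (V : LMod.{u} k U) (x : U) (y : V.carrier) (u v : U) :
    H.diagMap V x y (H.tmul u v) = H.uv V (u * x) (V.act v y) :=
  H.liftUU_tmul _ _ u v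

/-- `diagMap` as a bilinear map. -/
def diagAux (V : LMod.{u} k U) : U →ₗ[k] V.carrier →ₗ[k] H.UU.carrier →ₗ[k] H.UV V :=
  LinearMap.mk₂ k (H.diagMap V)
    (fun x x' y => H.tmul_ext fun u v => by simp [mul_add])
    (fun c x y => H.tmul_ext fun u v => by simp)
    (fun x y y' => H.tmul_ext fun u v => by simp)
    (fun c x y => H.tmul_ext fun u v => by simp)

@[simp] theorem diagAux_tmul (V : LMod.{u} k U) (x : U) (y : V.carrier) (u v : U) :
    H.diagAux V x y (H.tmul u v) = H.uv V (u * x) (V.act v y) :=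
  H.diagMap_tmul V x y u v

theorem diagAux_act (V : LMod.{u} k U) (x : U) (y : V.carrier) (u v : U)
    (z : H.UU.carrier) :
    H.diagAux V (u * x) (V.act v y) z = H.diagAux V x y (H.mulRight u v z) := by
  refine LinearMap.congr_fun (g := (H.diagAux V x y).comp (H.mulRight u v))
    (H.tmul_ext fun a b => ?_) z
  simp [mul_assoc]

/-- The diagonal action `u (x ⊗ y) = u₍₁₎ x ⊗ u₍₂₎ y`. -/
def diagAct (V : LMod.{u} k U) (u : U) : Module.End k (H.UV V) :=
  H.liftUV ((H.diagAux V).compr₂ (LinearMap.applyₗ (H.Δ u)))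
    (fun a x y => by
      have h1 := H.diagAux_act V x y (H.t (op a)) 1 (H.Δ u)
      have h2 := H.diagAux_act V x y 1 (H.s a) (H.Δ u)
      simp only [map_one, Module.End.one_apply, one_mul] at h1 h2
      simp only [LinearMap.compr₂_apply, LinearMap.applyₗ_apply_apply]
      rw [h1, H.takeuchi, ← h2])

theorem diagAct_uv (V : LMod.{u} k U) (u : U) (x : U) (y : V.carrier) :
    H.diagAct V u (H.uv V x y) = H.diagAux V x y (H.Δ u) :=
  H.liftUV_uv _ _ x y

/-- The tensor product `U ⊗_A V` of left `U`-modules, with the diagonal action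
`u (x ⊗ y) = u₍₁₎ x ⊗ u₍₂₎ y`. -/
def diag (V : LMod.{u} k U) : LMod.{u} k U where
  carrier := H.UV V
  act := AlgHom.ofLinearMap
    { toFun := H.diagAct V
      map_add' := fun a b => H.uv_ext fun x y => by simp [diagAct_uv]
      map_smul' := fun c a => H.uv_ext fun x y => by simp [diagAct_uv] }
    (H.uv_ext fun x y => by simp [diagAct_uv, H.Δ_one])
    (fun u v => H.uv_ext fun x y => by
      obtain ⟨n, a, b, h⟩ := H.tmul_exists_sum (H.Δ v)
      simp only [LinearMap.coe_mk, AddHom.coe_mk, Module.End.mul_apply]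
      simp only [diagAct_uv, H.Δ_mul u v n a b h, h, map_sum, diagAux_tmul, diagAux_act])

/-- `pow n` is the `(n+1)`-fold tensor power `U ⊗_A ⋯ ⊗_A U` with the diagonal left `U`-action. -/
def pow : ℕ → LMod.{u} k U
  | 0 => H.reg
  | n + 1 => H.diag (pow n)

/-- The class of `u ⊗ v` in `diag V`. -/
def ud (V : LMod.{u} k U) : U →ₗ[k] V.carrier →ₗ[k] (H.diag V).carrier := H.uv V

section

variable {V : LMod.{u} k U} {Q : Type*} [AddCommGroup Q] [Module k Q]

theorem ud_bal (a : A) (u : U) (v : V.carrier) :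
    H.ud V (H.t (op a) * u) v = H.ud V u (V.act (H.s a) v) :=
  H.uv_bal a u v

/-- The universal property of `diag V`. -/
def liftD (f : U →ₗ[k] V.carrier →ₗ[k] Q)
    (h : ∀ a u v, f (H.t (op a) * u) v = f u (V.act (H.s a) v)) : (H.diag V).carrier →ₗ[k] Q :=
  H.liftUV f h

@[simp] theorem liftD_ud (f : U →ₗ[k] V.carrier →ₗ[k] Q)
    (h : ∀ a u v, f (H.t (op a) * u) v = f u (V.act (H.s a) v)) (u : U) (v : V.carrier) :
    H.liftD f h (H.ud V u v) = f u v :=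
  H.liftUV_uv f h u v

theorem ud_ext {f g : (H.diag V).carrier →ₗ[k] Q} (h : ∀ u v, f (H.ud V u v) = g (H.ud V u v)) :
    f = g :=
  H.uv_ext h

theorem act_ud (a x : U) (v : V.carrier) (n : ℕ) (y z : Fin n → U)
    (h : H.Δ a = ∑ i, H.tmul (y i) (z i)) :
    (H.diag V).act a (H.ud V x v) = ∑ i, H.ud V (y i * x) (V.act (z i) v) := by
  refine (H.diagAct_uv V a x v).trans ?_
  simp only [h, map_sum, diagAux_tmul]
  rfl

theorem t_ud (a : A) (x : U) (v : V.carrier) :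
    (H.diag V).act (H.t (op a)) (H.ud V x v) = H.ud V x (V.act (H.t (op a)) v) := by
  have := H.Δ_t_mul a 1 1 (fun _ => 1) (fun _ => 1) (by simp [H.Δ_one])
  rw [mul_one] at this
  simpa using H.act_ud _ x v 1 _ _ this

theorem s_ud (a : A) (x : U) (v : V.carrier) :
    (H.diag V).act (H.s a) (H.ud V x v) = H.ud V (H.s a * x) v := by
  have := H.Δ_s_mul a 1 1 (fun _ => 1) (fun _ => 1) (by simp [H.Δ_one])
  rw [mul_one] at this
  simpa using H.act_ud _ x v 1 _ _ this

end

/-! #### The spaces `U^{⊗_A n} ⊗_A N` -/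

/-- `id ⊗ f : U ⊗_A N → U ⊗_A N'`. -/
def tenMapLin {N N' : LMod.{u} k A} (f : N.Hom N') :
    (H.ten N).carrier →ₗ[k] (H.ten N').carrier :=
  H.liftU ((H.ut N').compl₂ f.toLin) (fun a u n => by simp [STRing.ut_bal, f.map_act])

@[simp] theorem tenMapLin_ut {N N' : LMod.{u} k A} (f : N.Hom N') (u : U) (n : N.carrier) :
    H.tenMapLin f (H.ut N u n) = H.ut N' u (f.toLin n) :=
  H.liftU_ut _ _ u n

/-- `id ⊗ f : U ⊗_A N → U ⊗_A N'`, as a morphism of left `A`-modules. -/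
def tenMap {N N' : LMod.{u} k A} (f : N.Hom N') : (H.ten N).Hom (H.ten N') where
  toLin := H.tenMapLin f
  map_act := fun a z => by
    refine LinearMap.congr_fun (f := (H.tenMapLin f).comp ((H.ten N).act a))
      (g := ((H.ten N').act a).comp (H.tenMapLin f)) (H.ut_ext fun u n => ?_) z
    simp [STRing.act_ut]

/-- `C^n = U ⊗_A ⋯ ⊗_A U ⊗_A N` (`n` factors `U`), with the left `A`-action on the first factor. -/
def cochain (N : LMod.{u} k A) : ℕ → LMod.{u} k A
  | 0 => N
  | n + 1 => H.ten (cochain N n)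

/-- The element `u¹ ⊗ ⋯ ⊗ uⁿ ⊗ p` of `C^n`. -/
def pureTensor (N : LMod.{u} k A) :
    (n : ℕ) → (Fin n → U) → N.carrier → (H.cochain N n).carrier
  | 0, _, p => p
  | n + 1, w, p => H.ut (H.cochain N n) (w 0) (pureTensor N n (fun i => w i.succ) p)

section

variable (V : LMod.{u} k U) (N : LMod.{u} k A)

/-- `x ⊗ p ↦ (u ⊗ x) ⊗ p`. -/
def reassocAux : U →ₗ[k] (H.tens V N).carrier →ₗ[k] (H.tens (H.diag V) N).carrier :=
  LinearMap.flip (H.lift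
    (LinearMap.mk₂ k (fun x p => ((H.tm (H.diag V) N).flip p).comp ((H.ud V).flip x))
      (fun x x' p => by ext u; simp) (fun c x p => by ext u; simp)
      (fun x p p' => by ext u; simp) (fun c x p => by ext u; simp))
    (fun a x p => by
      ext u
      simp [← STRing.tm_bal, t_ud]))

@[simp] theorem reassocAux_tm (u : U) (x : V.carrier) (p : N.carrier) :
    H.reassocAux V N u (H.tm V N x p) = H.tm (H.diag V) N (H.ud V u x) p := by
  simp [reassocAux]

/-- Reassociation `U ⊗_A (V ⊗_A N) → (U ⊗_A V) ⊗_A N`, `u ⊗ (x ⊗ p) ↦ (u ⊗ x) ⊗ p`. -/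
def reassocLin : (H.ten (H.tens V N)).carrier →ₗ[k] (H.tens (H.diag V) N).carrier :=
  H.liftU (H.reassocAux V N) (fun a u z => by
    refine LinearMap.congr_fun (g := (H.reassocAux V N u).comp ((H.tens V N).act a))
      (H.hom_ext fun x p => ?_) z
    simp [STRing.act_tm, ud_bal])

@[simp] theorem reassocLin_ut (u : U) (z : (H.tens V N).carrier) :
    H.reassocLin V N (H.ut (H.tens V N) u z) = H.reassocAux V N u z :=
  H.liftU_ut _ _ u z

/-- Reassociation as a morphism of left `A`-modules. -/
def reassoc : (H.ten (H.tens V N)).Hom (H.tens (H.diag V) N) where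
  toLin := H.reassocLin V N
  map_act := fun a z => by
    refine LinearMap.congr_fun (f := (H.reassocLin V N).comp ((H.ten (H.tens V N)).act a))
      (g := ((H.tens (H.diag V) N).act a).comp (H.reassocLin V N)) (H.ut_ext fun u n => ?_) z
    simp only [LinearMap.comp_apply, STRing.act_ut, reassocLin_ut]
    refine LinearMap.congr_fun
      (g := ((H.tens (H.diag V) N).act a).comp (H.reassocAux V N u))
      (H.hom_ext fun x p => ?_) n
    simp [STRing.act_tm, s_ud]

/-- `u ⊗ x ↦ (p ↦ u ⊗ (x ⊗ p))`. -/
def unassocAux : (H.diag V).carrier →ₗ[k] N.carrier →ₗ[k] (H.ten (H.tens V N)).carrier :=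
  H.liftD
    (LinearMap.mk₂ k (fun u x => (H.ut (H.tens V N) u).comp (H.tm V N x))
      (fun x x' p => by ext u; simp) (fun c x p => by ext u; simp)
      (fun x p p' => by ext u; simp) (fun c x p => by ext u; simp))
    (fun a u x => by ext p; simp [STRing.ut_bal, STRing.act_tm])

@[simp] theorem unassocAux_ud (u : U) (x : V.carrier) (p : N.carrier) :
    H.unassocAux V N (H.ud V u x) p = H.ut (H.tens V N) u (H.tm V N x p) := by
  simp [unassocAux]

/-- Reassociation `(U ⊗_A V) ⊗_A N → U ⊗_A (V ⊗_A N)`, `(u ⊗ x) ⊗ p ↦ u ⊗ (x ⊗ p)`. -/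
def unassocLin : (H.tens (H.diag V) N).carrier →ₗ[k] (H.ten (H.tens V N)).carrier :=
  H.lift (H.unassocAux V N) (fun a z p => by
    refine LinearMap.congr_fun
      (f := ((H.unassocAux V N).flip p).comp ((H.diag V).act (H.t (op a))))
      (g := (H.unassocAux V N).flip (N.act a p)) (H.ud_ext fun u x => ?_) z
    simp [t_ud, STRing.tm_bal])

@[simp] theorem unassocLin_tm (z : (H.diag V).carrier) (p : N.carrier) :
    H.unassocLin V N (H.tm (H.diag V) N z p) = H.unassocAux V N z p :=
  H.lift_tm _ _ z p

/-- Reassociation as a morphism of left `A`-modules. -/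
def unassoc : (H.tens (H.diag V) N).Hom (H.ten (H.tens V N)) where
  toLin := H.unassocLin V N
  map_act := fun a z => by
    refine LinearMap.congr_fun (f := (H.unassocLin V N).comp ((H.tens (H.diag V) N).act a))
      (g := ((H.ten (H.tens V N)).act a).comp (H.unassocLin V N)) (H.hom_ext fun z p => ?_) z
    simp only [LinearMap.comp_apply, STRing.act_tm, unassocLin_tm]
    refine LinearMap.congr_fun
      (f := ((H.unassocAux V N).flip p).comp ((H.diag V).act (H.s a)))
      (g := ((H.ten (H.tens V N)).act a).comp ((H.unassocAux V N).flip p))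
      (H.ud_ext fun u x => ?_) z
    simp [s_ud, STRing.act_ut]

end

/-- Composition of module morphisms. -/
def _root_.HopfAlgd.LMod.Hom.comp {M₁ M₂ M₃ : LMod.{u} k A} (g : M₂.Hom M₃) (f : M₁.Hom M₂) :
    M₁.Hom M₃ where
  toLin := g.toLin.comp f.toLin
  map_act := fun a m => by simp [f.map_act, g.map_act]

/-- `u¹ ⊗ (⋯ ⊗ (uⁿ⁺¹ ⊗ p)) ↦ (u¹ ⊗ ⋯ ⊗ uⁿ⁺¹) ⊗ p`. -/
def split (N : LMod.{u} k A) : (n : ℕ) → (H.cochain N (n + 1)).Hom (H.tens (H.pow n) N)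
  | 0 => ⟨LinearMap.id, fun _ _ => rfl⟩
  | n + 1 => (H.reassoc (H.pow n) N).comp (H.tenMap (split N n))

/-- `(u¹ ⊗ ⋯ ⊗ uⁿ⁺¹) ⊗ p ↦ u¹ ⊗ (⋯ ⊗ (uⁿ⁺¹ ⊗ p))`. -/
def join (N : LMod.{u} k A) : (n : ℕ) → (H.tens (H.pow n) N).Hom (H.cochain N (n + 1))
  | 0 => ⟨LinearMap.id, fun _ _ => rfl⟩
  | n + 1 => (H.tenMap (join N n)).comp (H.unassoc (H.pow n) N)

/-- `u ⊗ p ↦ u v ⊗ p` on `U_◁ ⊗_A N`. -/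
def rightMul (N : LMod.{u} k A) (v : U) : Module.End k (H.ten N).carrier :=
  H.liftU ((H.ut N).comp (LinearMap.mulRight k v)) (fun a u n => by
    simp [mul_assoc, STRing.ut_bal])

end HopfAlgebroid

/-! ### Stable anti-Yetter-Drinfeld modules -/

section SAYD

variable {k A : Type*} {U : Type u} [Field k] [Ring A] [Algebra k A] [Ring U] [Algebra k U]

/-- A right `U`-module `P` (a module over `Uᵐᵒᵖ`) which is also a left `U`-comodule over its left
`A`-module structure, such that the two induced right `A^e`-module structures agree. -/
structure PreAYD (H : HopfAlgebroid k A U) (P : Type u) [AddCommGroup P] [Module k P]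
    [Module A P] [IsScalarTower k A P] [Module Uᵐᵒᵖ P] [IsScalarTower k Uᵐᵒᵖ P] where
  /-- The coaction `p ↦ p₍₋₁₎ ⊗ p₍₀₎`. -/
  coact : P →ₗ[k] (H.ten (LMod.of k A P)).carrier
  coact_smul : ∀ (a : A) (p : P), coact (a • p) = (H.ten (LMod.of k A P)).act a (coact p)
  /-- `Δ p₍₋₁₎ ⊗ p₍₀₎ = p₍₋₁₎ ⊗ Δ_P p₍₀₎` -/
  coassoc : ∀ (p : P) (n : ℕ) (x : Fin n → U) (q : Fin n → P),
    coact p = ∑ i, H.ut (LMod.of k A P) (x i) (q i) →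
      ∑ i, H.assoc (LMod.of k A P) (H.Δ (x i)) (q i) =
        ∑ i, H.ut (H.ten (LMod.of k A P)) (x i) (coact (q i))
  /-- `ε(p₍₋₁₎) p₍₀₎ = p` -/
  counit : ∀ (p : P) (n : ℕ) (x : Fin n → U) (q : Fin n → P),
    coact p = ∑ i, H.ut (LMod.of k A P) (x i) (q i) → ∑ i, H.ε (x i) • q i = p
  /-- `p s(a) t(b) = b ε(p₍₋₁₎ s(a)) p₍₀₎` -/
  compat : ∀ (a b : A) (p : P) (n : ℕ) (x : Fin n → U) (q : Fin n → P),
    coact p = ∑ i, H.ut (LMod.of k A P) (x i) (q i) →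
      op (H.s a * H.t (op b)) • p = b • ∑ i, H.ε (x i * H.s a) • q i

variable {H : HopfAlgebroid k A U} {P : Type u} [AddCommGroup P] [Module k P]
  [Module A P] [IsScalarTower k A P] [Module Uᵐᵒᵖ P] [IsScalarTower k Uᵐᵒᵖ P]

namespace PreAYD

/-- `P` as a left `A`-module. -/
abbrev lmod (_ : PreAYD H P) : LMod.{u} k A := LMod.of k A P

theorem t_smul (M : PreAYD H P) (a : A) (p : P) : op (H.t (op a)) • p = a • p := by
  obtain ⟨n, x, q, h⟩ := H.ut_exists_sum (M.coact p)
  have h1 := M.compat 1 a p n x q h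
  have h2 := M.counit p n x q h
  simp only [map_one, one_mul, mul_one] at h1
  rw [h1, h2]

/-- The coaction as a morphism of left `A`-modules `C^0 → C^1`. -/
def coactHom (M : PreAYD H P) : M.lmod.Hom (H.ten M.lmod) where
  toLin := M.coact
  map_act := M.coact_smul

/-- For `x ∈ V`, `p ∈ P` the map `w ⊗ v ↦ v x ⊗ p w` from `▶U ⊗_{A^op} U_◁` to `V ⊗_A P`. -/
def twistMap (M : PreAYD H P) (V : LMod.{u} k U) (x : V.carrier) (p : P) :
    H.UopU →ₗ[k] (H.tens V M.lmod).carrier :=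
  H.liftOp (LinearMap.mk₂ k
      (fun w v => H.tm V (LMod.of k A P) (V.act v x) ((op w • p : P)))
      (fun w w' v => by rw [op_add, add_smul]; exact map_add _ _ _)
      (fun c w v => by rw [op_smul, smul_assoc]; exact map_smul _ _ _)
      (fun w v v' => by simp) (fun c w v => by simp))
    (fun a w v => by
      have h := H.tm_bal (V := V) (N := LMod.of k A P) a (V.act v x) ((op w • p : P))
      simp only [LinearMap.mk₂_apply, map_mul, Module.End.mul_apply, op_mul, mul_smul, M.t_smul]
      exact h.symm)

theorem twistMap_omul (M : PreAYD H P) (V : LMod.{u} k U) (x : V.carrier) (p : P) (w v : U) :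
    M.twistMap V x p (H.omul w v) = H.tm V (LMod.of k A P) (V.act v x) ((op w • p : P)) :=
  H.liftOp_omul _ _ w v

/-- For `u ∈ U` and a left `U`-module `V`, the endomorphism `x ⊗ p ↦ u₋ x ⊗ p u₊` of `V ⊗_A P`. -/
def twist (M : PreAYD H P) (V : LMod.{u} k U) (u : U) :
    Module.End k (H.tens V M.lmod).carrier :=
  H.lift (V := V) (N := M.lmod) (LinearMap.mk₂ k (fun x (p : P) => M.twistMap V x p (H.transl u))
      (fun x x' p => by
        refine LinearMap.congr_fun (g := M.twistMap V x p + M.twistMap V x' p)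
          (H.omul_ext fun w v => ?_) _
        simp [twistMap_omul])
      (fun c x p => by
        refine LinearMap.congr_fun (g := c • M.twistMap V x p) (H.omul_ext fun w v => ?_) _
        simp [twistMap_omul])
      (fun x p p' => by
        refine LinearMap.congr_fun (g := M.twistMap V x p + M.twistMap V x p')
          (H.omul_ext fun w v => ?_) _
        simp only [twistMap_omul, smul_add, LinearMap.add_apply]
        exact map_add _ _ _)
      (fun c x p => by
        refine LinearMap.congr_fun (g := c • M.twistMap V x p) (H.omul_ext fun w v => ?_) _
        simp only [twistMap_omul, smul_comm _ c, LinearMap.smul_apply]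
        exact map_smul _ _ _))
    (fun a x p => by
      have h1 : M.twistMap V (V.act (H.t (op a)) x) p =
          (M.twistMap V x p).comp (H.oRight (H.t (op a))) :=
        H.omul_ext fun w v => by simp [twistMap_omul]
      have h2 : M.twistMap V x (op (H.t (op a)) • p) =
          (M.twistMap V x p).comp (H.oLeft (H.t (op a))) :=
        H.omul_ext fun w v => by simp [twistMap_omul, mul_smul]
      have h3 : (M.lmod.act a p : P) = op (H.t (op a)) • p := (M.t_smul a p).symm
      simp only [LinearMap.mk₂_apply]
      rw [h3, h1, h2, LinearMap.comp_apply, LinearMap.comp_apply, H.transl_t])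

theorem twist_tm (M : PreAYD H P) (V : LMod.{u} k U) (u : U) (x : V.carrier) (p : P) :
    M.twist V u (H.tm V M.lmod x p) = M.twistMap V x p (H.transl u) :=
  H.lift_tm (V := V) (N := M.lmod) _ _ x p

theorem twist_t_mul (M : PreAYD H P) (V : LMod.{u} k U) (a : A) (u : U)
    (z : (H.tens V M.lmod).carrier) :
    M.twist V (H.t (op a) * u) z = M.twist V u ((H.tens V M.lmod).act a z) := by
  refine LinearMap.congr_fun (g := (M.twist V u).comp ((H.tens V M.lmod).act a))
    (H.hom_ext fun x p => ?_) z
  have h1 : M.twistMap V (V.act (H.s a) x) p = (M.twistMap V x p).comp (H.oRight (H.s a)) :=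
    H.omul_ext fun w v => by simp [twistMap_omul]
  rw [LinearMap.comp_apply, STRing.act_tm, twist_tm, twist_tm, h1, H.transl_t_mul]
  rfl

theorem twist_add (M : PreAYD H P) (V : LMod.{u} k U) (u u' : U) :
    M.twist V (u + u') = M.twist V u + M.twist V u' :=
  H.hom_ext fun x p => by
    rw [LinearMap.add_apply, twist_tm, twist_tm, twist_tm, map_add, map_add]

theorem twist_smul (M : PreAYD H P) (V : LMod.{u} k U) (c : k) (u : U) :
    M.twist V (c • u) = c • M.twist V u :=
  H.hom_ext fun x p => by
    rw [LinearMap.smul_apply, twist_tm, twist_tm, map_smul, map_smul]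

end PreAYD

/-- A stable anti-Yetter-Drinfeld module. In the anti-Yetter-Drinfeld condition
`Δ_P(p u) = u₋ p₍₋₁₎ u₊₍₁₎ ⊗ p₍₀₎ u₊₍₂₎` the right-hand side is evaluated by means of
`u₊₍₁₎ ⊗ u₊₍₂₎ ⊗ u₋ = u₍₁₎ ⊗ u₍₂₎₊ ⊗ u₍₂₎₋`. -/
structure SAYD (H : HopfAlgebroid k A U) (P : Type u) [AddCommGroup P] [Module k P]
    [Module A P] [IsScalarTower k A P] [Module Uᵐᵒᵖ P] [IsScalarTower k Uᵐᵒᵖ P] extends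
    PreAYD H P where
  antiYD : ∀ (p : P) (u : U) (n : ℕ) (x y : Fin n → U), H.Δ u = ∑ i, H.tmul (x i) (y i) →
    coact (op u • p) =
      ∑ i, toPreAYD.twist H.reg (y i) (H.rightMul (LMod.of k A P) (x i) (coact p))
  /-- `p₍₀₎ p₍₋₁₎ = p` -/
  stable : ∀ (p : P) (n : ℕ) (x : Fin n → U) (q : Fin n → P),
    coact p = ∑ i, H.ut (LMod.of k A P) (x i) (q i) → ∑ i, op (x i) • q i = p

end SAYD

/-! ### Cocyclic modules and their cohomology -/

/-- The structure maps of a cocyclic `k`-module: cofaces `δ_i`, codegeneracies `σ_i`, cyclic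
operators `τ`. The cocyclic identities are not part of the structure. -/
structure Cocyclic (k : Type*) [Field k] where
  X : ℕ → Type u
  [grp : ∀ n, AddCommGroup (X n)]
  [mod : ∀ n, Module k (X n)]
  δ : ∀ n, Fin (n + 2) → X n →ₗ[k] X (n + 1)
  σ : ∀ n, Fin (n + 1) → X (n + 1) →ₗ[k] X n
  τ : ∀ n, X n →ₗ[k] X n

attribute [instance] Cocyclic.grp Cocyclic.mod

/-- The coboundaries in degree `n` of a sequence of maps `d n : X n → X (n+1)`. -/
def coboundaries {k : Type*} [Field k] {X : ℕ → Type u} [∀ n, AddCommGroup (X n)]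
    [∀ n, Module k (X n)] (d : ∀ n, X n →ₗ[k] X (n + 1)) : ∀ n, Submodule k (X n)
  | 0 => ⊥
  | n + 1 => LinearMap.range (d n)

/-- The `n`-th cohomology (cocycles modulo coboundaries) of a sequence of maps
`d n : X n → X (n+1)`. -/
abbrev Cohomology {k : Type*} [Field k] {X : ℕ → Type u} [∀ n, AddCommGroup (X n)]
    [∀ n, Module k (X n)] (d : ∀ n, X n →ₗ[k] X (n + 1)) (n : ℕ) : Type u :=
  LinearMap.ker (d n) ⧸ (coboundaries d n).submoduleOf (LinearMap.ker (d n))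

/-- The class of a cocycle. -/
abbrev cohClass {k : Type*} [Field k] {X : ℕ → Type u} [∀ n, AddCommGroup (X n)]
    [∀ n, Module k (X n)] (d : ∀ n, X n →ₗ[k] X (n + 1)) {n : ℕ} (z : X n) (hz : d n z = 0) :
    Cohomology d n :=
  Submodule.Quotient.mk ⟨z, hz⟩

namespace Cocyclic

variable {k : Type*} [Field k]

/-- A morphism of cocyclic modules: linear maps commuting with all structure maps. -/
structure Hom (E : Cocyclic.{u} k) (F : Cocyclic.{v} k) where
  toFun : ∀ n, E.X n →ₗ[k] F.X n
  comm_δ : ∀ n i z, toFun (n + 1) (E.δ n i z) = F.δ n i (toFun n z)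
  comm_σ : ∀ n i z, toFun n (E.σ n i z) = F.σ n i (toFun (n + 1) z)
  comm_τ : ∀ n z, toFun n (E.τ n z) = F.τ n (toFun n z)

variable (E : Cocyclic.{u} k)

/-- The Hochschild coboundary `b = ∑_{i=0}^{n+1} (-1)^i δ_i`. -/
def b (n : ℕ) : E.X n →ₗ[k] E.X (n + 1) := ∑ i : Fin (n + 2), (-1 : k) ^ (i : ℕ) • E.δ n i

/-- The operator `b' = ∑_{i=0}^{n} (-1)^i δ_i`. -/
def b' (n : ℕ) : E.X n →ₗ[k] E.X (n + 1) :=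
  ∑ i : Fin (n + 1), (-1 : k) ^ (i : ℕ) • E.δ n i.castSucc

/-- The signed cyclic operator `λ = (-1)^n τ_n`. -/
def lam (n : ℕ) : Module.End k (E.X n) := (-1 : k) ^ n • E.τ n

/-- The norm operator `N = 1 + λ + ⋯ + λ^n`. -/
def nrm (n : ℕ) : Module.End k (E.X n) := ∑ j ∈ Finset.range (n + 1), E.lam n ^ j

/-- Hochschild cohomology. -/
abbrev HH (n : ℕ) : Type u := Cohomology E.b n

/-- Vertical differential in column `p` of the cyclic bicomplex: `b` for `p` even, `-b'` for `p`
odd. -/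
def vert (p q : ℕ) : E.X q →ₗ[k] E.X (q + 1) := if Even p then E.b q else -E.b' q

/-- Horizontal differential from column `p` to column `p + 1` of the cyclic bicomplex: `1 - λ` for
`p` even, `N` for `p` odd. -/
def horiz (p q : ℕ) : E.X q →ₗ[k] E.X q := if Even p then 1 - E.lam q else E.nrm q

/-- The total complex of the cyclic bicomplex (whose entry at `(p, q)`, `p, q ≥ 0`, is `X q`):
in degree `n` it is the sum of the entries `(n - q, q)`, `0 ≤ q ≤ n`. -/
abbrev Tot (n : ℕ) : Type u := ∀ q : Fin (n + 1), E.X q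

/-- The total differential. -/
def totD (n : ℕ) : E.Tot n →ₗ[k] E.Tot (n + 1) :=
  LinearMap.pi fun q : Fin (n + 1 + 1) =>
    Fin.cases (motive := fun q : Fin (n + 1 + 1) => E.Tot n →ₗ[k] E.X q)
      ((E.horiz n 0).comp (LinearMap.proj (0 : Fin (n + 1))))
      (fun j => (E.vert (n - j) j).comp (LinearMap.proj j) +
        if hj : (j : ℕ) + 1 < n + 1 then
          (E.horiz (n - (j + 1)) (j + 1)).comp (LinearMap.proj (⟨j + 1, hj⟩ : Fin (n + 1)))
        else 0) q

/-- Cyclic cohomology, the cohomology of the total complex of the cyclic bicomplex. -/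
abbrev HC (n : ℕ) : Type u := Cohomology (X := E.Tot) E.totD n

end Cocyclic

/-! ### The cocyclic module of a Hopf algebroid with coefficients -/

section Complex

variable {k A : Type*} {U : Type u} [Field k] [Ring A] [Algebra k A] [Ring U] [Algebra k U]
  {H : HopfAlgebroid k A U} {P : Type u} [AddCommGroup P] [Module k P]
  [Module A P] [IsScalarTower k A P] [Module Uᵐᵒᵖ P] [IsScalarTower k Uᵐᵒᵖ P]

namespace HopfAlgebroid

theorem Δ_t_mul' (H : HopfAlgebroid k A U) (N : LMod.{u} k A) (a : A) (u : U) (n : N.carrier) :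
    H.assoc N (H.Δ (H.t (op a) * u)) n = H.assoc N (H.Δ u) (N.act a n) := by
  obtain ⟨m, x, y, h⟩ := H.tmul_exists_sum (H.Δ u)
  simp [H.Δ_t_mul a u m x y h, h, STRing.ut_bal]

/-- `Δ ⊗ id : U ⊗_A N → U ⊗_A (U ⊗_A N)`. -/
def comulLin (H : HopfAlgebroid k A U) (N : LMod.{u} k A) :
    (H.ten N).carrier →ₗ[k] (H.ten (H.ten N)).carrier :=
  H.liftU ((H.assoc N).comp H.Δ) (fun a u n => H.Δ_t_mul' N a u n)

@[simp] theorem comulLin_ut (H : HopfAlgebroid k A U) (N : LMod.{u} k A) (u : U) (n : N.carrier) :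
    H.comulLin N (H.ut N u n) = H.assoc N (H.Δ u) n :=
  H.liftU_ut _ _ u n

/-- `Δ ⊗ id`, as a morphism of left `A`-modules. -/
def comulHom (H : HopfAlgebroid k A U) (N : LMod.{u} k A) :
    (H.ten N).Hom (H.ten (H.ten N)) where
  toLin := H.comulLin N
  map_act := fun a z => by
    refine LinearMap.congr_fun (f := (H.comulLin N).comp ((H.ten N).act a))
      (g := ((H.ten (H.ten N)).act a).comp (H.comulLin N)) (H.ut_ext fun u n => ?_) z
    obtain ⟨m, x, y, h⟩ := H.tmul_exists_sum (H.Δ u)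
    simp [STRing.act_ut, H.Δ_s_mul a u m x y h, h]

/-- `ε ⊗ id : U ⊗_A N → N`, `u ⊗ n ↦ ε(u) n`. -/
def counitLin (H : HopfAlgebroid k A U) (N : LMod.{u} k A) : (H.ten N).carrier →ₗ[k] N.carrier :=
  H.liftU (N.act.toLinearMap.comp H.ε) (fun a u n => by
    have := H.ε_bimod 1 a u
    simp only [map_one, one_mul] at this
    simp [this])

@[simp] theorem counitLin_ut (H : HopfAlgebroid k A U) (N : LMod.{u} k A) (u : U)
    (n : N.carrier) : H.counitLin N (H.ut N u n) = N.act (H.ε u) n :=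
  H.liftU_ut _ _ u n

/-- `ε ⊗ id`, as a morphism of left `A`-modules. -/
def counitHom (H : HopfAlgebroid k A U) (N : LMod.{u} k A) : (H.ten N).Hom N where
  toLin := H.counitLin N
  map_act := fun a z => by
    refine LinearMap.congr_fun (f := (H.counitLin N).comp ((H.ten N).act a))
      (g := (N.act a).comp (H.counitLin N)) (H.ut_ext fun u n => ?_) z
    have := H.ε_bimod a 1 u
    simp only [map_one, mul_one, op_one] at this
    simp [STRing.act_ut, this]

/-- `codeg n i : C^{n+1} → C^n` applies `ε` to the factor `u^{i+1}` (`0 ≤ i ≤ n`) and lets the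
result act on the next factor. -/
def codeg (H : HopfAlgebroid k A U) (N : LMod.{u} k A) :
    (n : ℕ) → ℕ → (H.cochain N (n + 1)).Hom (H.cochain N n)
  | 0, _ => H.counitHom N
  | n + 1, 0 => H.counitHom (H.cochain N (n + 1))
  | n + 1, i + 1 => H.tenMap (codeg H N n i)

end HopfAlgebroid

namespace PreAYD

/-- `coface n i : C^n → C^{n+1}` is `δ_{i+1}`: it applies `Δ` to the factor `u^{i+1}` if `i < n`, and
the coaction to the last factor `p` if `i = n`. -/
def coface (M : PreAYD H P) :
    (n : ℕ) → ℕ → (H.cochain M.lmod n).Hom (H.cochain M.lmod (n + 1))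
  | 0, _ => M.coactHom
  | n + 1, 0 => H.comulHom (H.cochain M.lmod n)
  | n + 1, i + 1 => H.tenMap (coface M n i)

/-- The cyclic operator: the identity on `C^0`, and
`τ(u¹ ⊗ ⋯ ⊗ uⁿ ⊗ p) = u¹₋₍₁₎ u² ⊗ ⋯ ⊗ u¹₋₍ₙ₋₁₎ uⁿ ⊗ u¹₋₍ₙ₎ p₍₋₁₎ ⊗ p₍₀₎ u¹₊` for `n ≥ 1`: with
`z = u² ⊗ ⋯ ⊗ uⁿ ⊗ p₍₋₁₎ ⊗ p₍₀₎` in `U^{⊗ n} ⊗_A P`, it is `u¹₋` acting diagonally on the factors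
`U` of `z` while `u¹₊` acts on `p₍₀₎` from the right. -/
def cyc (M : PreAYD H P) :
    (n : ℕ) → (H.cochain M.lmod n).carrier →ₗ[k] (H.cochain M.lmod n).carrier
  | 0 => LinearMap.id
  | n + 1 => H.liftU (N := H.cochain M.lmod n)
      (LinearMap.mk₂ k (fun u c => (H.join M.lmod n).toLin
          (M.twist (H.pow n) u ((H.split M.lmod n).toLin ((M.coface n n).toLin c))))
        (fun u u' c => by simp [twist_add])
        (fun r u c => by simp [twist_smul])
        (fun u c c' => by simp)
        (fun r u c => by simp))
      (fun a u c => by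
        simp [twist_t_mul, (M.coface n n).map_act, (H.split M.lmod n).map_act])

/-- The cocyclic module `C^•(U; P)`, `C^n = U ⊗_A ⋯ ⊗_A U ⊗_A P`. -/
def cocyclic (M : PreAYD H P) : Cocyclic.{u} k where
  X n := (H.cochain M.lmod n).carrier
  δ n i := Fin.cases (H.ut (H.cochain M.lmod n) 1) (fun j => (M.coface n j).toLin) i
  σ n i := (H.codeg M.lmod n i).toLin
  τ n := M.cyc n

end PreAYD

end Complex

/-! ### Measurings -/

/-- A right comodule over a coalgebra. -/
structure RightComodule (k C D : Type*) [Field k] [AddCommGroup C] [Module k C] [Coalgebra k C]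
    [AddCommGroup D] [Module k D] where
  ρ : D →ₗ[k] D ⊗[k] C
  coassoc : TensorProduct.assoc k D C C ∘ₗ ρ.rTensor C ∘ₗ ρ =
    (Coalgebra.comul (R := k) (A := C)).lTensor D ∘ₗ ρ
  counit : (Coalgebra.counit (R := k) (A := C)).lTensor D ∘ₗ ρ = (TensorProduct.mk k D k).flip 1

/-- `Ψ : C → Hom_k(R, R')` is a measuring of algebras:
`x(ab) = x₍₁₎(a) x₍₂₎(b)` and `x(1) = ε(x) 1`. -/
structure IsMeasuring {k C R R' : Type*} [Field k] [AddCommGroup C] [Module k C] [Coalgebra k C]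
    [Ring R] [Algebra k R] [Ring R'] [Algebra k R'] (Ψ : C →ₗ[k] R →ₗ[k] R') : Prop where
  map_mul : ∀ x a b, Ψ x (a * b) =
    LinearMap.mul' k R' (TensorProduct.map (Ψ.flip a) (Ψ.flip b) (Coalgebra.comul (R := k) x))
  map_one : ∀ x, Ψ x 1 = Coalgebra.counit (R := k) x • (1 : R')

section Measuring

variable {k A A' : Type*} {U : Type u} {U' : Type v} [Field k] [Ring A] [Algebra k A] [Ring U]
  [Algebra k U] [Ring A'] [Algebra k A'] [Ring U'] [Algebra k U']

/-- A `C`-measuring of Hopf algebroids. -/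
structure Measuring (C : Type*) [AddCommGroup C] [Module k C] [Coalgebra k C]
    (H : HopfAlgebroid k A U) (H' : HopfAlgebroid k A' U') where
  Ψ : C →ₗ[k] U →ₗ[k] U'
  ψ : C →ₗ[k] A →ₗ[k] A'
  isMeasuring_Ψ : IsMeasuring Ψ
  isMeasuring_ψ : IsMeasuring ψ
  map_s : ∀ x a, Ψ x (H.s a) = H'.s (ψ x a)
  map_t : ∀ x a, Ψ x (H.t (op a)) = H'.t (op (ψ x a))
  map_S : ∀ x u, Ψ x (H.S u) = H'.S (Ψ x u)
  map_ε : ∀ x u, ψ x (H.ε u) = H'.ε (Ψ x u)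
  /-- `Δ'(x(u)) = x₍₁₎(u₍₁₎) ⊗ x₍₂₎(u₍₂₎)` -/
  map_Δ : ∀ (x : C) (u : U) (n : ℕ) (v w : Fin n → U), H.Δ u = ∑ i, H.tmul (v i) (w i) →
    H'.Δ (Ψ x u) = ∑ i, TensorProduct.lift (H'.tmul.compl₁₂ (Ψ.flip (v i)) (Ψ.flip (w i)))
      (Coalgebra.comul (R := k) x)

variable {C D : Type*} [AddCommGroup C] [Module k C] [Coalgebra k C] [AddCommGroup D] [Module k D]
  {H : HopfAlgebroid k A U} {H' : HopfAlgebroid k A' U'}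
  {P : Type u} [AddCommGroup P] [Module k P]
  [Module A P] [IsScalarTower k A P] [Module Uᵐᵒᵖ P] [IsScalarTower k Uᵐᵒᵖ P]
  {P' : Type v} [AddCommGroup P'] [Module k P']
  [Module A' P'] [IsScalarTower k A' P'] [Module U'ᵐᵒᵖ P'] [IsScalarTower k U'ᵐᵒᵖ P']

/-- `Ω : D → Hom_k(P, P')` is a comodule measuring of SAYD modules over the measuring `m` of Hopf
algebroids; `ρ` is the right `C`-comodule structure of `D`. -/
structure IsComoduleMeasuring (m : Measuring C H H') (ρ : RightComodule k C D)
    (M : SAYD H P) (M' : SAYD H' P') (Ω : D →ₗ[k] P →ₗ[k] P') : Prop where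
  /-- `y(p u) = y₍₀₎(p) y₍₁₎(u)` -/
  map_smul : ∀ (y : D) (p : P) (u : U) (n : ℕ) (d : Fin n → D) (c : Fin n → C),
    ρ.ρ y = ∑ i, d i ⊗ₜ[k] c i → Ω y (op u • p) = ∑ i, op (m.Ψ (c i) u) • Ω (d i) p
  /-- `Δ'_{P'}(y(p)) = y₍₁₎(p₍₋₁₎) ⊗ y₍₀₎(p₍₀₎)` -/
  map_coact : ∀ (y : D) (p : P) (l : ℕ) (w : Fin l → U) (q : Fin l → P) (n : ℕ) (d : Fin n → D)
    (c : Fin n → C), M.coact p = ∑ j, H.ut (LMod.of k A P) (w j) (q j) →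
    ρ.ρ y = ∑ i, d i ⊗ₜ[k] c i →
      M'.coact (Ω y p) =
        ∑ j, ∑ i, H'.ut (LMod.of k A' P') (m.Ψ (c i) (w j)) (Ω (d i) (q j))

/-- `x ↦ x₍₁₎(u¹) ⊗ ⋯ ⊗ x₍ₙ₎(uⁿ) ⊗ q` in `U'^{⊗ n} ⊗_{A'} N`; for `n = 0` it is `x ↦ ε(x) q`. -/
def Measuring.spread (m : Measuring C H H') (N : LMod.{v} k A') (q : N.carrier) :
    (n : ℕ) → (Fin n → U) → C →ₗ[k] (H'.cochain N n).carrier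
  | 0, _ => (Coalgebra.counit (R := k) (A := C)).smulRight q
  | n + 1, w => TensorProduct.lift ((H'.ut (H'.cochain N n)).compl₁₂ (m.Ψ.flip (w 0))
      (spread m N q n (fun i => w i.succ))) ∘ₗ Coalgebra.comul (R := k) (A := C)

/-- The family `Φ` is given by the action of `y ∈ D`:
`Φ(u¹ ⊗ ⋯ ⊗ uⁿ ⊗ p) = y₍₁₎(u¹) ⊗ ⋯ ⊗ y₍ₙ₎(uⁿ) ⊗ y₍₀₎(p)` for all `n ≥ 0`. -/
def IsActionOf (m : Measuring C H H') (ρ : RightComodule k C D) (M : SAYD H P) (M' : SAYD H' P')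
    (Ω : D →ₗ[k] P →ₗ[k] P') (y : D)
    (Φ : ∀ n, M.cocyclic.X n →ₗ[k] M'.cocyclic.X n) : Prop :=
  ∀ (n : ℕ) (w : Fin n → U) (p : P) (l : ℕ) (d : Fin l → D) (c : Fin l → C),
    ρ.ρ y = ∑ i, d i ⊗ₜ[k] c i →
      Φ n (H.pureTensor M.lmod n w p) = ∑ i, m.spread M'.lmod (Ω (d i) p) n w (c i)

end Measuring

end HopfAlgd

end

/-! The cofaces, codegeneracies and cyclic operators are assembled from the products, units,
$\Delta$, $\epsilon$, the coaction, the right action on $P$ and the translation map $u\mapsto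
u_+\otimes u_-$. An element of $C$ or $D$ passes through each of these at the price of splitting
into Sweedler legs. Hence the two sides of every identity to be proved are one and the same
multilinear expression in the legs of an iterated coaction of $y$, up to the bracketing of the
splittings and the order of the $C$-legs. Coassociativity (`sw_sw`) removes the first difference,
cocommutativity (`sw_swap`, `sw_sw_self_rotate`) the second.

The definition of a measuring says nothing about the translation map. Its compatibility, `transl_Ψ`,
follows because a measuring commutes with the Hopf-Galois map $\beta$ (`galois_opMap`), $\beta'$ is
injective, and $x(1)=\epsilon(x)1$.

Since the tensor products over $A$ are quotients, the formula on elementary tensors has to be shown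
to descend. This is done one factor at a time. A `Family` is a collection of maps $N\to N'$ indexed
by $D$ with $y(an)=y_{(1)}(a)\,y_{(0)}(n)$; this semilinearity is exactly what makes $u\otimes
n\mapsto y_{(1)}(u)\otimes y_{(0)}(n)$ balanced over $A$, and the new collection is again a
`Family`. Induction gives `cochainFamily` on all $U^{\otimes_A n}\otimes_A P$, and commutation with
a structure map is inherited under $U\otimes_A-$ (`Intertwines.tenMap`), so cofaces and
codegeneracies only have to be treated at the factor where they act.

For $\tau$ the factors $U$ are regrouped into one left $U$-module with diagonal action. There $\tau$
is the last coface, followed by regrouping, by $x\otimes p\mapsto u_-x\otimes pu_+$, and by undoing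
the regrouping; each factor commutes with the families, the third one by `tensFamily_twist`. -/

noncomputable section

open TensorProduct MulOpposite

namespace HopfAlgd

set_option linter.unusedSectionVars false

/-! ### Sweedler calculus for comodules -/

section Multilinear

variable (k : Type*) [Field k] {X Y Z W Q : Type*} [AddCommGroup X] [Module k X]
  [AddCommGroup Y] [Module k Y] [AddCommGroup Z] [Module k Z] [AddCommGroup W] [Module k W]
  [AddCommGroup Q] [Module k Q]

/-- Linearity in each of two variables. -/
structure IsBilin (B : X → Y → Q) : Prop where
  fst : ∀ y, IsLinearMap k (fun x => B x y)
  snd : ∀ x, IsLinearMap k (fun y => B x y)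

/-- Linearity in each of three variables. -/
structure IsTrilin (B : X → Y → Z → Q) : Prop where
  fst : ∀ y z, IsLinearMap k (fun x => B x y z)
  snd : ∀ x z, IsLinearMap k (fun y => B x y z)
  trd : ∀ x y, IsLinearMap k (fun z => B x y z)

/-- Linearity in each of four variables. -/
structure IsQuadrilin (B : X → Y → Z → W → Q) : Prop where
  fst : ∀ y z w, IsLinearMap k (fun x => B x y z w)
  snd : ∀ x z w, IsLinearMap k (fun y => B x y z w)
  trd : ∀ x y w, IsLinearMap k (fun z => B x y z w)
  fth : ∀ x y z, IsLinearMap k (fun w => B x y z w)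

variable {k}

/-- Cyclically permuted arguments keep the map quadrilinear, so `sw_sw_self_rotate` can be iterated.
-/
theorem IsQuadrilin.rotate {T : X → Y → Y → Y → Q} (h : IsQuadrilin k T) :
    IsQuadrilin k (fun x y₁ y₂ y₃ => T x y₃ y₁ y₂) :=
  ⟨fun _ _ _ => h.fst _ _ _, fun _ _ _ => h.trd _ _ _, fun _ _ _ => h.fth _ _ _,
    fun _ _ _ => h.snd _ _ _⟩

/-- The bundled form of a bilinear function. -/
def IsBilin.toLin {B : X → Y → Q} (h : IsBilin k B) : X →ₗ[k] Y →ₗ[k] Q :=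
  LinearMap.mk₂ k B (fun x x' y => (h.fst y).map_add x x') (fun c x y => (h.fst y).map_smul c x)
    (fun x y y' => (h.snd x).map_add y y') (fun c x y => (h.snd x).map_smul c y)

@[simp] theorem IsBilin.toLin_apply {B : X → Y → Q} (h : IsBilin k B) (x : X) (y : Y) :
    h.toLin x y = B x y := rfl

theorem exists_sum_tmul (z : X ⊗[k] Y) :
    ∃ (n : ℕ) (a : Fin n → X) (b : Fin n → Y), z = ∑ i, a i ⊗ₜ[k] b i := by
  obtain ⟨S, rfl⟩ := TensorProduct.exists_finset (R := k) z
  refine ⟨S.card, fun i => (S.equivFin.symm i).1.1, fun i => (S.equivFin.symm i).1.2, ?_⟩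
  rw [← Finset.sum_coe_sort]
  exact (S.equivFin.symm.sum_comp (fun j : S => j.1.1 ⊗ₜ[k] j.1.2)).symm

end Multilinear

namespace RightComodule

variable {k C D : Type*} [Field k] [AddCommGroup C] [Module k C] [Coalgebra k C]
  [AddCommGroup D] [Module k D] {Q Q' : Type*} [AddCommGroup Q] [Module k Q]
  [AddCommGroup Q'] [Module k Q']

/-- A coalgebra as a right comodule over itself. -/
def self (k C : Type*) [Field k] [AddCommGroup C] [Module k C] [Coalgebra k C] :
    RightComodule k C C where
  ρ := Coalgebra.comul
  coassoc := Coalgebra.coassoc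
  counit := Coalgebra.lTensor_counit_comp_comul

variable (ρ : RightComodule k C D)

/-- The number of terms of a chosen expression `ρ y = ∑ i, d i ⊗ c i`. -/
def size (y : D) : ℕ := (exists_sum_tmul (ρ.ρ y)).choose

/-- The left tensor factors of a chosen expression `ρ y = ∑ i, d i ⊗ c i`. -/
def left (y : D) : Fin (ρ.size y) → D := (exists_sum_tmul (ρ.ρ y)).choose_spec.choose

/-- The right tensor factors of a chosen expression `ρ y = ∑ i, d i ⊗ c i`. -/
def right (y : D) : Fin (ρ.size y) → C := (exists_sum_tmul (ρ.ρ y)).choose_spec.choose_spec.choose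

theorem ρ_eq_sum (y : D) : ρ.ρ y = ∑ i, ρ.left y i ⊗ₜ[k] ρ.right y i :=
  (exists_sum_tmul (ρ.ρ y)).choose_spec.choose_spec.choose_spec

/-- `B(y₍₀₎, y₍₁₎)`; this is independent of choices if `B` is bilinear. -/
def sw (y : D) (B : D → C → Q) : Q := ∑ i, B (ρ.left y i) (ρ.right y i)

/-- For bilinear $B$ the chosen expression is immaterial, since the sum is a linear function of `ρ.ρ
y`. Independence of choices and linearity in $y$ both come from here. -/
theorem sw_eq_lift {B : D → C → Q} (h : IsBilin k B) (y : D) :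
    ρ.sw y B = TensorProduct.lift h.toLin (ρ.ρ y) := by
  simp [sw, ρ.ρ_eq_sum y]

theorem sw_lin (B : D →ₗ[k] C →ₗ[k] Q) (y : D) :
    ρ.sw y (fun d c => B d c) = TensorProduct.lift B (ρ.ρ y) := by
  simp [sw, ρ.ρ_eq_sum y]

theorem sw_eq_sum {B : D → C → Q} (h : IsBilin k B) {y : D} {n : ℕ} {d : Fin n → D}
    {c : Fin n → C} (e : ρ.ρ y = ∑ i, d i ⊗ₜ[k] c i) : ρ.sw y B = ∑ i, B (d i) (c i) := by
  simp [ρ.sw_eq_lift h, e]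

theorem sw_isLinear {B : D → C → Q} (h : IsBilin k B) : IsLinearMap k (fun y => ρ.sw y B) := by
  constructor <;> intros <;> simp [ρ.sw_eq_lift h]

/-- `sw` is a finite sum over an expression fixed once for each $y$, so the rules up to `sw_congr`
hold for arbitrary functions $B$. Multilinearity enters only where the counit, coassociativity or
cocommutativity is used. -/
theorem sw_add (y : D) (B B' : D → C → Q) :
    ρ.sw y (fun d c => B d c + B' d c) = ρ.sw y B + ρ.sw y B' :=
  Finset.sum_add_distrib

theorem sw_smul (y : D) (r : k) (B : D → C → Q) :
    ρ.sw y (fun d c => r • B d c) = r • ρ.sw y B :=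
  Finset.smul_sum.symm

theorem sw_zero (y : D) : ρ.sw y (fun _ _ => (0 : Q)) = 0 :=
  Finset.sum_const_zero

theorem sw_sum {ι : Type*} [Fintype ι] (y : D) (B : ι → D → C → Q) :
    ρ.sw y (fun d c => ∑ i, B i d c) = ∑ i, ρ.sw y (B i) :=
  Finset.sum_comm

theorem map_sw (f : Q →ₗ[k] Q') (y : D) (B : D → C → Q) :
    f (ρ.sw y B) = ρ.sw y (fun d c => f (B d c)) :=
  map_sum f _ _

theorem sw_apply (y : D) (B : D → C → Q →ₗ[k] Q') (q : Q) :
    ρ.sw y B q = ρ.sw y (fun d c => B d c q) := by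
  simp [sw]

theorem sw_congr {y : D} {B B' : D → C → Q} (h : ∀ d c, B d c = B' d c) :
    ρ.sw y B = ρ.sw y B' :=
  Finset.sum_congr rfl fun _ _ => h _ _

theorem sw_counit {f : D → Q} (h : IsLinearMap k f) (y : D) :
    ρ.sw y (fun d c => Coalgebra.counit (R := k) c • f d) = f y := by
  have h1 := congrArg (TensorProduct.lift ((LinearMap.lsmul k Q).flip.comp (IsLinearMap.mk' f h)))
    (LinearMap.congr_fun ρ.counit y)
  simp only [LinearMap.comp_apply, ρ.ρ_eq_sum y, map_sum] at h1
  simpa [sw] using h1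

/-- Coassociativity. -/
theorem sw_sw {T : D → C → C → Q} (h : IsTrilin k T) (y : D) :
    ρ.sw y (fun d c => ρ.sw d (fun d' c' => T d' c' c)) =
      ρ.sw y (fun d c => (self k C).sw c (fun c₁ c₂ => T d c₁ c₂)) := by
  -- $T$ is packaged as a linear map on $D\otimes(C\otimes C)$, to be applied to both sides of the
  -- coassociativity axiom.
  let T₁ : D → C ⊗[k] C →ₗ[k] Q := fun d =>
    TensorProduct.lift (IsBilin.toLin (B := T d) ⟨fun c => h.snd d c, fun c => h.trd d c⟩)
  let T₂ : D →ₗ[k] C ⊗[k] C →ₗ[k] Q :=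
    { toFun := T₁
      map_add' := fun d d' => TensorProduct.ext' fun c c' => (h.fst c c').map_add d d'
      map_smul' := fun r d => TensorProduct.ext' fun c c' => (h.fst c c').map_smul r d }
  have hT : ∀ d c c', T₂ d (c ⊗ₜ c') = T d c c' := fun d c c' => rfl
  have h1 := congrArg (TensorProduct.lift T₂) (LinearMap.congr_fun ρ.coassoc y)
  have h2 : ∀ c, Coalgebra.comul (R := k) c = ∑ i, (self k C).left c i ⊗ₜ[k] (self k C).right c i :=
    fun c => (self k C).ρ_eq_sum c
  simp only [LinearMap.comp_apply, ρ.ρ_eq_sum y, map_sum, LinearMap.rTensor_tmul,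
    LinearMap.lTensor_tmul, ρ.ρ_eq_sum (ρ.left y _), h2, sum_tmul, tmul_sum,
    LinearEquiv.coe_coe, TensorProduct.assoc_tmul, TensorProduct.lift.tmul, hT] at h1
  exact h1

/-- Cocommutativity. -/
theorem self_sw_comm [Coalgebra.IsCocomm k C] {B : C → C → Q} (h : IsBilin k B) (c : C) :
    (self k C).sw c B = (self k C).sw c (fun c₁ c₂ => B c₂ c₁) := by
  have h' : IsBilin k (fun c₁ c₂ => B c₂ c₁) := ⟨h.snd, h.fst⟩
  rw [sw_eq_lift _ h, sw_eq_lift _ h']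
  change _ = TensorProduct.lift h'.toLin (Coalgebra.comul (R := k) c)
  rw [← Coalgebra.comm_comul k c]
  have : TensorProduct.lift h'.toLin ∘ₗ (TensorProduct.comm k C C).toLinearMap =
      TensorProduct.lift h.toLin := TensorProduct.ext' fun _ _ => rfl
  exact (LinearMap.congr_fun this (Coalgebra.comul (R := k) c)).symm

/-- By coassociativity the two $C$-legs of the twice iterated coaction become the two legs of one
coproduct in $C$, where cocommutativity exchanges them. -/
theorem sw_swap [Coalgebra.IsCocomm k C] {T : D → C → C → Q} (h : IsTrilin k T) (y : D) :
    ρ.sw y (fun d c => ρ.sw d (fun d' c' => T d' c' c)) =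
      ρ.sw y (fun d c => ρ.sw d (fun d' c' => T d' c c')) := by
  have h' : IsTrilin k (fun d c c' => T d c' c) :=
    ⟨fun _ _ => h.fst _ _, fun _ _ => h.trd _ _, fun _ _ => h.snd _ _⟩
  rw [ρ.sw_sw h, ρ.sw_sw h']
  exact ρ.sw_congr fun d c => self_sw_comm ⟨fun _ => h.snd _ _, fun _ => h.trd _ _⟩ c

/-- Coassociativity turns splitting both $y_{(0)}$ and $y_{(1)}$ into coacting three times in
succession. In that normal form neighbouring legs can be exchanged by `sw_swap`. -/
theorem sw_sw_self {T : D → C → C → C → Q} (h : IsQuadrilin k T) (y : D) :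
    ρ.sw y (fun d c => ρ.sw d (fun d' c' => (self k C).sw c (fun c₁ c₂ => T d' c' c₁ c₂))) =
      ρ.sw y (fun d c => ρ.sw d (fun d' c' => ρ.sw d' (fun d'' c'' => T d'' c'' c' c))) := by
  have h1 : IsTrilin k (fun d c₁ c₂ => ρ.sw d (fun d' c' => T d' c' c₁ c₂)) :=
    ⟨fun c₁ c₂ => ρ.sw_isLinear ⟨fun _ => h.fst _ _ _, fun _ => h.snd _ _ _⟩,
      fun d c₂ => ⟨fun a b => by simp only [(h.trd _ _ _).map_add, sw_add],
        fun r a => by simp only [(h.trd _ _ _).map_smul, sw_smul]⟩,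
      fun d c₂ => ⟨fun a b => by simp only [(h.fth _ _ _).map_add, sw_add],
        fun r a => by simp only [(h.fth _ _ _).map_smul, sw_smul]⟩⟩
  rw [ρ.sw_sw h1]
  exact ρ.sw_congr fun d c => Finset.sum_comm

/-- Invariance of `T(y₍₀₎, y₍₁₎, y₍₂₎, y₍₃₎)` under a cyclic permutation of the last three
arguments. -/
theorem sw_sw_self_rotate [Coalgebra.IsCocomm k C] {T : D → C → C → C → Q}
    (h : IsQuadrilin k T) (y : D) :
    ρ.sw y (fun d c => ρ.sw d (fun d' c' => (self k C).sw c (fun c₁ c₂ => T d' c' c₁ c₂))) =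
      ρ.sw y (fun d c => ρ.sw d (fun d' c' => (self k C).sw c (fun c₁ c₂ => T d' c₂ c' c₁))) := by
  have h' := h.rotate
  rw [ρ.sw_sw_self h, ρ.sw_sw_self h']
  -- The 3-cycle is a product of two exchanges of neighbouring legs: `hl` serves the two innermost
  -- legs, `hr` the two outermost ones.
  have hl : ∀ c, IsTrilin k (fun d c₁ c₂ => T d c₁ c₂ c) := fun c =>
    ⟨fun _ _ => h.fst _ _ _, fun _ _ => h.snd _ _ _, fun _ _ => h.trd _ _ _⟩
  have hr : IsTrilin k (fun d c₁ c₂ => ρ.sw d (fun d' c' => T d' c₁ c' c₂)) :=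
    ⟨fun c₁ c₂ => ρ.sw_isLinear ⟨fun _ => h.fst _ _ _, fun _ => h.trd _ _ _⟩,
      fun d c₂ => ⟨fun a b => by simp only [(h.snd _ _ _).map_add, sw_add],
        fun r a => by simp only [(h.snd _ _ _).map_smul, sw_smul]⟩,
      fun d c₂ => ⟨fun a b => by simp only [(h.fth _ _ _).map_add, sw_add],
        fun r a => by simp only [(h.fth _ _ _).map_smul, sw_smul]⟩⟩
  rw [ρ.sw_congr fun d c => ρ.sw_swap (hl c) d]
  exact ρ.sw_swap hr y

end RightComodule

/-! ### Induction on elementary tensors -/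

section Induction

variable {k A : Type*} {U : Type u} [Field k] [Ring A] [Algebra k A] [Ring U] [Algebra k U]

theorem STRing.tm_induction (H : STRing k A U) {V : LMod.{u} k U} {N : LMod.{u} k A}
    {p : (H.tens V N).carrier → Prop} (h0 : p 0) (h : ∀ v n, p (H.tm V N v n))
    (ha : ∀ x y, p x → p y → p (x + y)) (z : (H.tens V N).carrier) : p z :=
  Bal.ind h0 h ha z

theorem HopfAlgebroid.ud_induction (H : HopfAlgebroid k A U) {V : LMod.{u} k U}
    {p : (H.diag V).carrier → Prop} (h0 : p 0) (h : ∀ u v, p (H.ud V u v))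
    (ha : ∀ x y, p x → p y → p (x + y)) (z : (H.diag V).carrier) : p z :=
  Bal.ind h0 h ha z

theorem HopfAlgebroid.omul_induction (H : HopfAlgebroid k A U) {p : H.UopU → Prop} (h0 : p 0)
    (h : ∀ u v, p (H.omul u v)) (ha : ∀ x y, p x → p y → p (x + y)) (z : H.UopU) : p z :=
  Bal.ind h0 h ha z

end Induction

/-! ### Semilinear families of maps along a measuring, and their tensor products -/

section Families

variable {k A A' : Type*} {U : Type u} {U' : Type v} [Field k] [Ring A] [Algebra k A] [Ring U]
  [Algebra k U] [Ring A'] [Algebra k A'] [Ring U'] [Algebra k U']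
  {C D : Type*} [AddCommGroup C] [Module k C] [Coalgebra k C] [AddCommGroup D] [Module k D]
  {H : HopfAlgebroid k A U} {H' : HopfAlgebroid k A' U'}

open RightComodule (self)

namespace Measuring

variable (m : Measuring C H H')

theorem Ψ_mul (x : C) (u w : U) :
    m.Ψ x (u * w) = (self k C).sw x (fun c₁ c₂ => m.Ψ c₁ u * m.Ψ c₂ w) := by
  rw [m.isMeasuring_Ψ.map_mul, (show Coalgebra.comul (R := k) x = _ from (self k C).ρ_eq_sum x)]
  simp [RightComodule.sw]

/-- Cocommutativity permits the reversed order of legs. It is the order of a right comodule: the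
first leg acts on the module element and the second on the scalar, so that $U$ itself fits the
convention of `UFamily` and `Family`. -/
theorem Ψ_mul' [Coalgebra.IsCocomm k C] (x : C) (u w : U) :
    m.Ψ x (u * w) = (self k C).sw x (fun c₁ c₂ => m.Ψ c₂ u * m.Ψ c₁ w) := by
  rw [Ψ_mul, RightComodule.self_sw_comm]
  constructor <;> intros <;> constructor <;> intros <;> simp [add_mul, mul_add]

theorem Δ_Ψ (x : C) (u : U) (n : ℕ) (v w : Fin n → U) (h : H.Δ u = ∑ i, H.tmul (v i) (w i)) :
    H'.Δ (m.Ψ x u) =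
      ∑ i, (self k C).sw x (fun c₁ c₂ => H'.tmul (m.Ψ c₁ (v i)) (m.Ψ c₂ (w i))) := by
  rw [m.map_Δ x u n v w h]
  refine Finset.sum_congr rfl fun i _ => ?_
  exact ((self k C).sw_lin (H'.tmul.compl₁₂ (m.Ψ.flip (v i)) (m.Ψ.flip (w i))) x).symm

/-- A family of linear maps `V → V'` between left modules over `U` and `U'`, parametrized by `C`
and compatible with the actions along the measuring: `x(u v) = x₍₂₎(u) x₍₁₎(v)`. -/
structure UFamily (V : LMod.{u} k U) (V' : LMod.{v} k U') where
  toLin : C →ₗ[k] V.carrier →ₗ[k] V'.carrier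
  map_act : ∀ x a v, toLin x (V.act a v) =
    (self k C).sw x (fun c₁ c₂ => V'.act (m.Ψ c₂ a) (toLin c₁ v))

/-- A family of linear maps `N → N'` between left modules over `A` and `A'`, parametrized by a
comodule `D` and compatible with the actions along the measuring: `y(a n) = y₍₁₎(a) y₍₀₎(n)`. -/
structure Family (ρ : RightComodule k C D) (N : LMod.{u} k A) (N' : LMod.{v} k A') where
  toLin : D →ₗ[k] N.carrier →ₗ[k] N'.carrier
  map_act : ∀ y a n, toLin y (N.act a n) = ρ.sw y (fun d c => N'.act (m.ψ c a) (toLin d n))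

variable {m} {ρ : RightComodule k C D}

/-- The measuring as a family of maps between the regular modules. -/
def regFamily [Coalgebra.IsCocomm k C] (m : Measuring C H H') : m.UFamily H.reg H'.reg where
  toLin := m.Ψ
  map_act := fun x a w => m.Ψ_mul' x a w

variable {V : LMod.{u} k U} {V' : LMod.{v} k U'} {N : LMod.{u} k A} {N' : LMod.{v} k A'}

theorem UFamily.map_t (Φ : m.UFamily V V') (x : C) (a : A) (w : V.carrier) :
    Φ.toLin x (V.act (H.t (op a)) w) =
      (self k C).sw x (fun c₁ c₂ => V'.act (H'.t (op (m.ψ c₂ a))) (Φ.toLin c₁ w)) := by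
  simp only [Φ.map_act, m.map_t]

theorem UFamily.map_s (Φ : m.UFamily V V') (x : C) (a : A) (w : V.carrier) :
    Φ.toLin x (V.act (H.s a) w) =
      (self k C).sw x (fun c₁ c₂ => V'.act (H'.s (m.ψ c₂ a)) (Φ.toLin c₁ w)) := by
  simp only [Φ.map_act, m.map_s]

section

variable [Coalgebra.IsCocomm k C]

/-- The linear map `v ⊗ n ↦ y₍₁₎(v) ⊗ y₍₀₎(n)`. -/
def tensFamilyLin (Φ : m.UFamily V V') (F : m.Family ρ N N') (y : D) :
    (H.tens V N).carrier →ₗ[k] (H'.tens V' N').carrier :=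
  H.lift (LinearMap.mk₂ k
      (fun w n => ρ.sw y (fun d c => H'.tm V' N' (Φ.toLin c w) (F.toLin d n)))
      (fun w w' n => by simp [RightComodule.sw_add])
      (fun r w n => by simp [RightComodule.sw_smul])
      (fun w n n' => by simp [RightComodule.sw_add])
      (fun r w n => by simp [RightComodule.sw_smul]))
    (fun a w n => by
      -- Balancedness over $A$. Moving $t(a)$ across the tensor sign turns both sides into this
      -- expression, with the two $C$-legs in opposite orders; this is where cocommutativity is
      -- needed.
      have h : IsTrilin k (fun d c₁ c₂ =>
          H'.tm V' N' (Φ.toLin c₁ w) (N'.act (m.ψ c₂ a) (F.toLin d n))) := by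
        constructor <;> intros <;> constructor <;> intros <;> simp
      simp only [LinearMap.mk₂_apply, Φ.map_t, F.map_act, RightComodule.map_sw,
        RightComodule.sw_apply, STRing.tm_bal]
      exact (ρ.sw_sw h y).symm.trans (ρ.sw_swap h y))

theorem tensFamilyLin_tm (Φ : m.UFamily V V') (F : m.Family ρ N N') (y : D) (w : V.carrier)
    (n : N.carrier) : tensFamilyLin Φ F y (H.tm V N w n) =
      ρ.sw y (fun d c => H'.tm V' N' (Φ.toLin c w) (F.toLin d n)) :=
  H.lift_tm _ _ w n

theorem isBilin_tm (Φ : m.UFamily V V') (F : m.Family ρ N N') (w : V.carrier) (n : N.carrier) :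
    IsBilin k (fun d c => H'.tm V' N' (Φ.toLin c w) (F.toLin d n)) := by
  constructor <;> intros <;> constructor <;> intros <;> simp

/-- The family `v ⊗ n ↦ y₍₁₎(v) ⊗ y₍₀₎(n)` on `V ⊗_A N`. -/
def tensFamily (Φ : m.UFamily V V') (F : m.Family ρ N N') :
    m.Family ρ (H.tens V N) (H'.tens V' N') where
  toLin :=
    { toFun := tensFamilyLin Φ F
      map_add' := fun y y' => H.hom_ext fun w n => by
        simp only [LinearMap.add_apply, tensFamilyLin_tm,
          (ρ.sw_isLinear (isBilin_tm Φ F w n)).map_add]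
      map_smul' := fun r y => H.hom_ext fun w n => by
        simp only [LinearMap.smul_apply, tensFamilyLin_tm, RingHom.id_apply,
          (ρ.sw_isLinear (isBilin_tm Φ F w n)).map_smul] }
  map_act := fun y a z => by
    refine H.tm_induction (p := fun z => tensFamilyLin Φ F y ((H.tens V N).act a z) =
      ρ.sw y (fun d c => (H'.tens V' N').act (m.ψ c a) (tensFamilyLin Φ F d z)))
      ?_ (fun w n => ?_) (fun z z' h h' => ?_) z
    · simp [RightComodule.sw_zero]
    -- Here $a$ acts on the first factor through $s$, and the legs already occur in the same order,
    -- so coassociativity suffices.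
    · have h : IsTrilin k (fun d c₁ c₂ =>
          H'.tm V' N' (V'.act (H'.s (m.ψ c₂ a)) (Φ.toLin c₁ w)) (F.toLin d n)) := by
        constructor <;> intros <;> constructor <;> intros <;> simp
      simp only [STRing.act_tm, tensFamilyLin_tm, RightComodule.map_sw, Φ.map_s,
        RightComodule.sw_apply]
      exact (ρ.sw_sw h y).symm
    · simp only [map_add, h, h', RightComodule.sw_add]

theorem tensFamily_tm (Φ : m.UFamily V V') (F : m.Family ρ N N') (y : D) (w : V.carrier)
    (n : N.carrier) : (tensFamily Φ F).toLin y (H.tm V N w n) =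
      ρ.sw y (fun d c => H'.tm V' N' (Φ.toLin c w) (F.toLin d n)) :=
  tensFamilyLin_tm Φ F y w n

/-- The family `u ⊗ n ↦ y₍₁₎(u) ⊗ y₍₀₎(n)` on `U ⊗_A N`. -/
def tenFamily (F : m.Family ρ N N') : m.Family ρ (H.ten N) (H'.ten N') :=
  tensFamily m.regFamily F

theorem tenFamily_ut (F : m.Family ρ N N') (y : D) (w : U) (n : N.carrier) :
    (tenFamily F).toLin y (H.ut N w n) =
      ρ.sw y (fun d c => H'.ut N' (m.Ψ c w) (F.toLin d n)) :=
  tensFamilyLin_tm m.regFamily F y w n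

/-- The family induced by a comodule family on `U^{⊗_A n} ⊗_A N`. -/
def cochainFamily (F : m.Family ρ N N') : (n : ℕ) → m.Family ρ (H.cochain N n) (H'.cochain N' n)
  | 0 => F
  | n + 1 => tenFamily (cochainFamily F n)

/-- The linear map `u ⊗ v ↦ x₍₂₎(u) ⊗ x₍₁₎(v)`. -/
def diagFamilyLin (Φ : m.UFamily V V') (x : C) : (H.diag V).carrier →ₗ[k] (H'.diag V').carrier :=
  H.liftD (LinearMap.mk₂ k
      (fun a w => (self k C).sw x (fun c₁ c₂ => H'.ud V' (m.Ψ c₂ a) (Φ.toLin c₁ w)))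
      (fun w w' n => by simp [RightComodule.sw_add])
      (fun r w n => by simp [RightComodule.sw_smul])
      (fun w n n' => by simp [RightComodule.sw_add])
      (fun r w n => by simp [RightComodule.sw_smul]))
    (fun a w n => by
      have h : IsTrilin k (fun c c₁ c₂ =>
          H'.ud V' (m.Ψ c₁ w) (V'.act (H'.s (m.ψ c₂ a)) (Φ.toLin c n))) := by
        constructor <;> intros <;> constructor <;> intros <;> simp
      simp only [LinearMap.mk₂_apply, Φ.map_s, RightComodule.map_sw, m.Ψ_mul', m.map_t,
        RightComodule.sw_apply, HopfAlgebroid.ud_bal]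
      exact ((self k C).sw_sw h x).symm.trans ((self k C).sw_swap h x))

theorem diagFamilyLin_ud (Φ : m.UFamily V V') (x : C) (a : U) (w : V.carrier) :
    diagFamilyLin Φ x (H.ud V a w) =
      (self k C).sw x (fun c₁ c₂ => H'.ud V' (m.Ψ c₂ a) (Φ.toLin c₁ w)) :=
  H.liftD_ud _ _ a w

theorem isBilin_ud (Φ : m.UFamily V V') (a : U) (w : V.carrier) :
    IsBilin k (fun c₁ c₂ => H'.ud V' (m.Ψ c₂ a) (Φ.toLin c₁ w)) := by
  constructor <;> intros <;> constructor <;> intros <;> simp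

/-- The family `u ⊗ v ↦ x₍₂₎(u) ⊗ x₍₁₎(v)` on the diagonal tensor product `U ⊗_A V`. -/
def diagFamily (Φ : m.UFamily V V') : m.UFamily (H.diag V) (H'.diag V') where
  toLin :=
    { toFun := diagFamilyLin Φ
      map_add' := fun y y' => H.ud_ext fun w n => by
        simp only [LinearMap.add_apply, diagFamilyLin_ud,
          ((self k C).sw_isLinear (isBilin_ud Φ w n)).map_add]
      map_smul' := fun r y => H.ud_ext fun w n => by
        simp only [LinearMap.smul_apply, diagFamilyLin_ud, RingHom.id_apply,
          ((self k C).sw_isLinear (isBilin_ud Φ w n)).map_smul] }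
  map_act := fun x a z => by
    refine H.ud_induction (p := fun z => diagFamilyLin Φ x ((H.diag V).act a z) =
      (self k C).sw x (fun c₁ c₂ => (H'.diag V').act (m.Ψ c₂ a) (diagFamilyLin Φ c₁ z)))
      ?_ (fun w n => ?_) (fun z z' h h' => ?_) z
    · simp only [map_zero, RightComodule.sw_zero]
    · obtain ⟨l, y, z, e⟩ := H.tmul_exists_sum (H.Δ a)
      -- The diagonal action of $c(a)$ is governed by $\Delta'(c(a))$, which `Δ_Ψ` expresses through
      -- the fixed expression of $\Delta a$.
      have hact : ∀ (c : C) (p : U') (q : V'.carrier),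
          (H'.diag V').act (m.Ψ c a) (H'.ud V' p q) = ∑ i, (self k C).sw c (fun c₁ c₂ =>
            H'.ud V' (m.Ψ c₁ (y i) * p) (V'.act (m.Ψ c₂ (z i)) q)) := fun c p q => by
        refine (H'.diagAct_uv V' _ p q).trans ?_
        rw [m.Δ_Ψ c a l y z e]
        simp only [map_sum, RightComodule.map_sw, HopfAlgebroid.diagAux_tmul]
        rfl
      have h : ∀ i, IsQuadrilin k (fun c c₁ c₂ c₃ =>
          H'.ud V' (m.Ψ c₂ (y i) * m.Ψ c₁ w) (V'.act (m.Ψ c₃ (z i)) (Φ.toLin c n))) := fun i => by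
        constructor <;> intros <;> constructor <;> intros <;> simp [mul_add, add_mul]
      simp only [H.act_ud a w n l y z e, map_sum, diagFamilyLin_ud, RightComodule.map_sw, hact,
        RightComodule.sw_sum, m.Ψ_mul', Φ.map_act, RightComodule.sw_apply]
      refine Finset.sum_congr rfl fun i _ => ?_
      have h' := (h i).rotate
      -- Acting first and measuring afterwards gives the legs that go to $w$, $y_i$, $z_i$ in a
      -- cyclically shifted order compared with measuring first. Two rotations make up for the
      -- shift.
      rw [(self k C).sw_sw_self_rotate (h i), (self k C).sw_sw_self_rotate h']
    · simp only [map_add, h, h', RightComodule.sw_add]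

theorem diagFamily_ud (Φ : m.UFamily V V') (x : C) (a : U) (w : V.carrier) :
    (diagFamily Φ).toLin x (H.ud V a w) =
      (self k C).sw x (fun c₁ c₂ => H'.ud V' (m.Ψ c₂ a) (Φ.toLin c₁ w)) :=
  diagFamilyLin_ud Φ x a w

/-- The family `u¹ ⊗ ⋯ ⊗ uⁿ⁺¹ ↦ x₍ₙ₊₁₎(u¹) ⊗ ⋯ ⊗ x₍₁₎(uⁿ⁺¹)` on tensor powers. -/
def powFamily (m : Measuring C H H') :
    (n : ℕ) → m.UFamily (H.pow n) (H'.pow n)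
  | 0 => m.regFamily
  | n + 1 => diagFamily (powFamily m n)

end

end Measuring

end Families

/-! ### Compatibility with regrouping, coproduct, counit and translation map -/

section Intertwining

variable {k A A' : Type*} {U : Type u} {U' : Type v} [Field k] [Ring A] [Algebra k A] [Ring U]
  [Algebra k U] [Ring A'] [Algebra k A'] [Ring U'] [Algebra k U']
  {C D : Type*} [AddCommGroup C] [Module k C] [Coalgebra k C] [AddCommGroup D] [Module k D]
  {H : HopfAlgebroid k A U} {H' : HopfAlgebroid k A' U'}

open RightComodule (self)

namespace Measuring

variable {m : Measuring C H H'} {ρ : RightComodule k C D}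

/-- The families `F` and `G` intertwine the morphisms `f` and `f'`. -/
def Intertwines {N M : LMod.{u} k A} {N' M' : LMod.{v} k A'} (F : m.Family ρ N N')
    (G : m.Family ρ M M') (f : N.Hom M) (f' : N'.Hom M') : Prop :=
  ∀ y n, G.toLin y (f.toLin n) = f'.toLin (F.toLin y n)

theorem Intertwines.comp {N M L : LMod.{u} k A} {N' M' L' : LMod.{v} k A'} {F : m.Family ρ N N'}
    {G : m.Family ρ M M'} {E : m.Family ρ L L'} {f : N.Hom M} {f' : N'.Hom M'} {g : M.Hom L}
    {g' : M'.Hom L'} (hg : Intertwines G E g g') (hf : Intertwines F G f f') :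
    Intertwines F E (g.comp f) (g'.comp f') := fun y n =>
  (hg y _).trans (congrArg g'.toLin (hf y n))

variable [Coalgebra.IsCocomm k C] {V : LMod.{u} k U} {V' : LMod.{v} k U'}
  {N M : LMod.{u} k A} {N' M' : LMod.{v} k A'}

/-- The inductive step for all structure maps that act on a factor further to the right. -/
theorem Intertwines.tenMap {F : m.Family ρ N N'} {G : m.Family ρ M M'} {f : N.Hom M}
    {f' : N'.Hom M'} (h : Intertwines F G f f') :
    Intertwines (tenFamily F) (tenFamily G) (H.tenMap f) (H'.tenMap f') := fun y z => by
  refine LinearMap.congr_fun (f := ((tenFamily G).toLin y).comp (H.tenMapLin f))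
    (g := (H'.tenMapLin f').comp ((tenFamily F).toLin y)) (H.ut_ext fun u n => ?_) z
  simp only [LinearMap.comp_apply, HopfAlgebroid.tenMapLin_ut, tenFamily_ut,
    RightComodule.map_sw, h _ _]

/-- Coassociativity alone: in `tensFamily` as in `diagFamily` later legs go to tensor factors
further left, so both bracketings give the same order of legs. -/
theorem intertwines_reassoc (Φ : m.UFamily V V') (F : m.Family ρ N N') :
    Intertwines (tenFamily (tensFamily Φ F)) (tensFamily (diagFamily Φ) F)
      (H.reassoc V N) (H'.reassoc V' N') := fun y z => by
  refine LinearMap.congr_fun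
    (f := ((tensFamily (diagFamily Φ) F).toLin y).comp (H.reassocLin V N))
    (g := (H'.reassocLin V' N').comp ((tenFamily (tensFamily Φ F)).toLin y))
    (H.ut_ext fun u n => ?_) z
  -- With $u$ fixed, both sides are linear in the remaining element of $V\otimes_A N$, so they are
  -- compared on $x\otimes p$.
  refine Eq.trans ?_ (LinearMap.congr_fun
    (f := ((tensFamily (diagFamily Φ) F).toLin y).comp (H.reassocAux V N u))
    (g := ((H'.reassocLin V' N').comp ((tenFamily (tensFamily Φ F)).toLin y)).comp
      (H.ut (H.tens V N) u)) (H.hom_ext fun x p => ?_) n)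
  · simp
  have h : IsTrilin k (fun d c₁ c₂ =>
      H'.tm (H'.diag V') N' (H'.ud V' (m.Ψ c₂ u) (Φ.toLin c₁ x)) (F.toLin d p)) := by
    constructor <;> intros <;> constructor <;> intros <;> simp
  simp only [LinearMap.comp_apply, HopfAlgebroid.reassocAux_tm, tensFamily_tm, tenFamily_ut,
    RightComodule.map_sw, HopfAlgebroid.reassocLin_ut, diagFamily_ud, RightComodule.sw_apply]
  exact (ρ.sw_sw h y).symm

theorem intertwines_unassoc (Φ : m.UFamily V V') (F : m.Family ρ N N') :
    Intertwines (tensFamily (diagFamily Φ) F) (tenFamily (tensFamily Φ F))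
      (H.unassoc V N) (H'.unassoc V' N') := fun y z => by
  refine LinearMap.congr_fun
    (f := ((tenFamily (tensFamily Φ F)).toLin y).comp (H.unassocLin V N))
    (g := (H'.unassocLin V' N').comp ((tensFamily (diagFamily Φ) F).toLin y))
    (H.hom_ext fun n p => ?_) z
  refine Eq.trans ?_ (LinearMap.congr_fun
    (f := ((tenFamily (tensFamily Φ F)).toLin y).comp ((H.unassocAux V N).flip p))
    (g := ((H'.unassocLin V' N').comp ((tensFamily (diagFamily Φ) F).toLin y)).comp
      ((H.tm (H.diag V) N).flip p)) (H.ud_ext fun u x => ?_) n)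
  · simp
  have h : IsTrilin k (fun d c₁ c₂ =>
      H'.ut (H'.tens V' N') (m.Ψ c₂ u) (H'.tm V' N' (Φ.toLin c₁ x) (F.toLin d p))) := by
    constructor <;> intros <;> constructor <;> intros <;> simp
  simp only [LinearMap.comp_apply, HopfAlgebroid.unassocAux_ud, tensFamily_tm, tenFamily_ut,
    RightComodule.map_sw, HopfAlgebroid.unassocLin_tm, diagFamily_ud, RightComodule.sw_apply,
    LinearMap.flip_apply]
  exact ρ.sw_sw h y

theorem intertwines_split (F : m.Family ρ N N') : (n : ℕ) →
    Intertwines (cochainFamily F (n + 1)) (tensFamily (powFamily m n) F)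
      (H.split N n) (H'.split N' n)
  | 0 => fun _ _ => rfl
  | n + 1 => (intertwines_reassoc (powFamily m n) F).comp (intertwines_split F n).tenMap

theorem intertwines_join (F : m.Family ρ N N') : (n : ℕ) →
    Intertwines (tensFamily (powFamily m n) F) (cochainFamily F (n + 1))
      (H.join N n) (H'.join N' n)
  | 0 => fun _ _ => rfl
  | n + 1 => (intertwines_join F n).tenMap.comp (intertwines_unassoc (powFamily m n) F)

/-- The measuring property of $\Delta$ gives the earlier leg to $u_{(1)}$, whereas two applications
of `tenFamily` give it to $u_{(2)}$. Cocommutativity reconciles the two. -/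
theorem intertwines_comul (F : m.Family ρ N N') :
    Intertwines (tenFamily F) (tenFamily (tenFamily F)) (H.comulHom N) (H'.comulHom N') :=
  fun y z => by
  refine LinearMap.congr_fun
    (f := ((tenFamily (tenFamily F)).toLin y).comp (H.comulLin N))
    (g := (H'.comulLin N').comp ((tenFamily F).toLin y)) (H.ut_ext fun u n => ?_) z
  obtain ⟨l, v, w, e⟩ := H.tmul_exists_sum (H.Δ u)
  have h : ∀ i, IsTrilin k (fun d c c' =>
      H'.ut (H'.ten N') (m.Ψ c (v i)) (H'.ut N' (m.Ψ c' (w i)) (F.toLin d n))) := fun i => by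
    constructor <;> intros <;> constructor <;> intros <;> simp
  simp only [LinearMap.comp_apply, HopfAlgebroid.comulLin_ut, e, map_sum, tenFamily_ut,
    RightComodule.map_sw, LinearMap.sum_apply, STRing.assoc_tmul, m.Δ_Ψ _ u l v w e,
    RightComodule.sw_sum, RightComodule.sw_apply]
  exact Finset.sum_congr rfl fun i _ => ((ρ.sw_swap (h i) y).symm.trans (ρ.sw_sw (h i) y))

/-- Since $\psi$ and $\Psi$ commute with $\epsilon$, this is the semilinearity of $F$ for the scalar
$\epsilon(u)$. -/
theorem intertwines_counit (F : m.Family ρ N N') :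
    Intertwines (tenFamily F) F (H.counitHom N) (H'.counitHom N') := fun y z => by
  refine LinearMap.congr_fun (f := (F.toLin y).comp (H.counitLin N))
    (g := (H'.counitLin N').comp ((tenFamily F).toLin y)) (H.ut_ext fun u n => ?_) z
  simp only [LinearMap.comp_apply, HopfAlgebroid.counitLin_ut, tenFamily_ut,
    RightComodule.map_sw, F.map_act, m.map_ε]

theorem intertwines_codeg (F : m.Family ρ N N') : (n i : ℕ) →
    Intertwines (cochainFamily F (n + 1)) (cochainFamily F n) (H.codeg N n i) (H'.codeg N' n i)
  | 0, _ => intertwines_counit F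
  | n + 1, 0 => intertwines_counit (cochainFamily F (n + 1))
  | n + 1, i + 1 => (intertwines_codeg F n i).tenMap

/-- This is commutation with $\delta_0$: from $x(1)=\epsilon(x)1$ and the counit axiom of $D$. -/
theorem tenFamily_one (F : m.Family ρ N N') (y : D) (n : N.carrier) :
    (tenFamily F).toLin y (H.ut N 1 n) = H'.ut N' 1 (F.toLin y n) := by
  rw [tenFamily_ut, ← ρ.sw_counit (f := fun d => H'.ut N' 1 (F.toLin d n)) (by
    constructor <;> intros <;> simp) y]
  exact ρ.sw_congr fun d c => by simp [m.isMeasuring_Ψ.map_one]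

/-! ### The translation map -/

/-- The linear map `u ⊗ v ↦ x₍₁₎(u) ⊗ x₍₂₎(v)` on `▶U ⊗_{A^op} U_◁`. -/
def opMap (m : Measuring C H H') (x : C) : H.UopU →ₗ[k] H'.UopU :=
  H.liftOp (LinearMap.mk₂ k
      (fun u w => (self k C).sw x (fun c₁ c₂ => H'.omul (m.Ψ c₁ u) (m.Ψ c₂ w)))
      (fun w w' n => by simp [RightComodule.sw_add])
      (fun r w n => by simp [RightComodule.sw_smul])
      (fun w n n' => by simp [RightComodule.sw_add])
      (fun r w n => by simp [RightComodule.sw_smul]))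
    (fun a u w => by
      -- The legs occur in their natural order on both sides of $ut(a)\otimes w=u\otimes t(a)w$, so
      -- descent to the quotient needs only coassociativity.
      have h : IsTrilin k (fun c c₁ c₂ =>
          H'.omul (m.Ψ c u) (H'.t (op (m.ψ c₁ a)) * m.Ψ c₂ w)) := by
        constructor <;> intros <;> constructor <;> intros <;> simp [add_mul, mul_add]
      simp only [LinearMap.mk₂_apply, m.Ψ_mul, m.map_t, RightComodule.map_sw,
        RightComodule.sw_apply, HopfAlgebroid.omul_bal]
      exact (self k C).sw_sw h x)

theorem opMap_omul (x : C) (u w : U) :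
    m.opMap x (H.omul u w) = (self k C).sw x (fun c₁ c₂ => H'.omul (m.Ψ c₁ u) (m.Ψ c₂ w)) :=
  H.liftOp_omul _ _ u w

/-- The action of `C` on `U_◁ ⊗_A ▷U`, as a family. -/
def srcFamily (m : Measuring C H H') : m.Family (self k C) (H.src H.reg) (H'.src H'.reg) where
  toLin := m.Ψ
  map_act := fun x a w => m.regFamily.map_s x a w

/-- $\beta$ is built from $\Delta$ and the product, and both are respected by the measuring: each
side becomes $x_{(1)}(u_{(1)})\otimes x_{(2)}(u_{(2)})\,x_{(3)}(w)$. -/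
theorem galois_opMap (x : C) (z : H.UopU) :
    H'.galois (m.opMap x z) = (tenFamily (srcFamily m)).toLin x (H.galois z) := by
  refine LinearMap.congr_fun (f := H'.galois.comp (m.opMap x))
    (g := ((tenFamily (srcFamily m)).toLin x).comp H.galois) (H.omul_ext fun u w => ?_) z
  obtain ⟨l, v, v', e⟩ := H.tmul_exists_sum (H.Δ u)
  have h : ∀ i, IsTrilin k (fun c c₁ c₂ =>
      H'.tmul (m.Ψ c (v i)) (m.Ψ c₁ (v' i) * m.Ψ c₂ w)) := fun i => by
    constructor <;> intros <;> constructor <;> intros <;> simp [add_mul, mul_add]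
  have h1 : ∀ u w, (tenFamily (srcFamily m)).toLin x (H.tmul u w) =
      (self k C).sw x (fun c₁ c₂ => H'.tmul (m.Ψ c₁ u) (m.Ψ c₂ w)) := fun u w => by
    rw [RightComodule.self_sw_comm]
    · exact tenFamily_ut (srcFamily m) x u w
    · constructor <;> intros <;> constructor <;> intros <;> simp
  simp only [LinearMap.comp_apply, HopfAlgebroid.galois_omul, opMap_omul, RightComodule.map_sw,
    m.Δ_Ψ _ u l v v' e, map_sum, e, STRing.mulRight_tmul, mul_one, h1, m.Ψ_mul,
    RightComodule.sw_sum]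
  exact Finset.sum_congr rfl fun i _ => (self k C).sw_sw (h i) x

/-- That is, $x(u)_+\otimes x(u)_-=x_{(1)}(u_+)\otimes x_{(2)}(u_-)$. Applying the injective map
$\beta'$ reduces it to $x(u)\otimes1=x_{(1)}(u)\otimes x_{(2)}(1)$, which is the counit axiom. -/
theorem transl_Ψ (x : C) (u : U) : H'.transl (m.Ψ x u) = m.opMap x (H.transl u) := by
  apply H'.galois_bijective.1
  rw [galois_opMap, H.galois_transl, H'.galois_transl]
  have h : IsBilin k (fun d c => H'.tmul (m.Ψ c u) (m.Ψ d 1)) := by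
    constructor <;> intros <;> constructor <;> intros <;> simp
  refine Eq.symm ((tenFamily_ut (srcFamily m) x u 1).trans
    ((RightComodule.self_sw_comm h x).trans ?_))
  rw [← (self k C).sw_counit (f := fun c => H'.tmul (m.Ψ c u) 1) (by
    constructor <;> intros <;> simp) x]
  exact (self k C).sw_congr fun c₁ c₂ => by simp [m.isMeasuring_Ψ.map_one]

end Measuring

end Intertwining

/-! ### Coefficients in SAYD modules and the cyclic operator -/

section Coefficients

variable {k A A' : Type*} {U : Type u} {U' : Type v} [Field k] [Ring A] [Algebra k A] [Ring U]
  [Algebra k U] [Ring A'] [Algebra k A'] [Ring U'] [Algebra k U']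
  {C D : Type*} [AddCommGroup C] [Module k C] [Coalgebra k C] [AddCommGroup D] [Module k D]
  {H : HopfAlgebroid k A U} {H' : HopfAlgebroid k A' U'}
  {P : Type u} [AddCommGroup P] [Module k P]
  [Module A P] [IsScalarTower k A P] [Module Uᵐᵒᵖ P] [IsScalarTower k Uᵐᵒᵖ P]
  {P' : Type v} [AddCommGroup P'] [Module k P']
  [Module A' P'] [IsScalarTower k A' P'] [Module U'ᵐᵒᵖ P'] [IsScalarTower k U'ᵐᵒᵖ P']
  {m : Measuring C H H'} {ρ : RightComodule k C D} {M : SAYD H P} {M' : SAYD H' P'}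
  {Ω : D →ₗ[k] P →ₗ[k] P'}

open RightComodule (self)

open Measuring

namespace IsComoduleMeasuring

theorem apply_op_smul (hΩ : IsComoduleMeasuring m ρ M M' Ω) (y : D) (p : P) (u : U) :
    Ω y (op u • p) = ρ.sw y (fun d c => op (m.Ψ c u) • Ω d p) :=
  hΩ.map_smul y p u _ _ _ (ρ.ρ_eq_sum y)

/-- A comodule measuring as a family of maps between left modules over `A` and `A'`. -/
def family (hΩ : IsComoduleMeasuring m ρ M M' Ω) : m.Family ρ M.lmod M'.lmod where
  toLin := Ω
  map_act := fun y a p => by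
    -- Semilinearity over $A$ is a special case of compatibility with the right $U$-action, because
    -- $ap=p\,t(a)$ in $P$ and in $P'$.
    have h := hΩ.apply_op_smul y p (H.t (op a))
    rw [M.t_smul] at h
    refine h.trans (ρ.sw_congr fun d c => ?_)
    rw [m.map_t, M'.t_smul]
    rfl

variable [Coalgebra.IsCocomm k C]

theorem intertwines_coact (hΩ : IsComoduleMeasuring m ρ M M' Ω) :
    Intertwines hΩ.family (tenFamily hΩ.family) M.coactHom M'.coactHom := fun y p => by
  obtain ⟨l, w, q, e⟩ := H.ut_exists_sum (M.coact p)
  refine Eq.trans ?_ (hΩ.map_coact y p l w q _ _ _ e (ρ.ρ_eq_sum y)).symm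
  change (tenFamily hΩ.family).toLin y (M.coact p) = _
  rw [e, map_sum]
  exact Finset.sum_congr rfl fun j _ => tenFamily_ut hΩ.family y (w j) (q j)

theorem intertwines_coface (hΩ : IsComoduleMeasuring m ρ M M' Ω) : (n i : ℕ) →
    Intertwines (cochainFamily hΩ.family n) (cochainFamily hΩ.family (n + 1))
      (M.coface n i) (M'.coface n i)
  | 0, _ => hΩ.intertwines_coact
  | n + 1, 0 => intertwines_comul (cochainFamily hΩ.family n)
  | n + 1, i + 1 => (intertwines_coface hΩ n i).tenMap

variable {V : LMod.{u} k U} {V' : LMod.{v} k U'}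

theorem tensFamily_family_tm (hΩ : IsComoduleMeasuring m ρ M M' Ω) (Φ : m.UFamily V V') (y : D)
    (x : V.carrier) (p : P) : (tensFamily Φ hΩ.family).toLin y (H.tm V M.lmod x p) =
      ρ.sw y (fun d c => H'.tm V' M'.lmod (Φ.toLin c x) (Ω d p)) :=
  tensFamily_tm Φ hΩ.family y x p

/-- Stated for arbitrary $z$ in place of $u_+\otimes u_-$, so that it can be checked on elementary
tensors $w\otimes v$. -/
theorem tensFamily_twistMap (hΩ : IsComoduleMeasuring m ρ M M' Ω) (Φ : m.UFamily V V') (y : D)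
    (x : V.carrier) (p : P) (z : H.UopU) :
    (tensFamily Φ hΩ.family).toLin y (M.twistMap V x p z) =
      ρ.sw y (fun d c => ρ.sw d (fun d' c' =>
        M'.twistMap V' (Φ.toLin c' x) (Ω d' p) (m.opMap c z))) := by
  refine H.omul_induction (p := fun z => (tensFamily Φ hΩ.family).toLin y (M.twistMap V x p z) =
      ρ.sw y (fun d c => ρ.sw d (fun d' c' =>
        M'.twistMap V' (Φ.toLin c' x) (Ω d' p) (m.opMap c z)))) ?_ (fun w v => ?_)
    (fun z z' h h' => ?_) z
  · simp only [map_zero, RightComodule.sw_zero]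
  · have h : IsQuadrilin k (fun d c₁ c₂ c₃ => H'.tm V' M'.lmod
        (V'.act (m.Ψ c₃ v) (Φ.toLin c₁ x)) (op (m.Ψ c₂ w) • Ω d p)) := by
      constructor <;> intros <;> constructor <;> intros <;>
        simp [add_smul, smul_assoc, smul_comm _ (_ : k)]
    rw [PreAYD.twistMap_omul, tensFamily_family_tm]
    simp only [PreAYD.twistMap_omul, opMap_omul, RightComodule.map_sw, hΩ.apply_op_smul,
      Φ.map_act, RightComodule.sw_apply]
    -- The two sides distribute three $C$-legs over $x$, $w$ and $v$ in orders that differ by a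
    -- 3-cycle followed by an exchange of the two legs of $y_{(1)}$.
    rw [ρ.sw_sw_self_rotate h]
    exact ρ.sw_congr fun d c => ρ.sw_congr fun d' c' => RightComodule.self_sw_comm (k := k)
      ⟨fun _ => h.snd _ _ _, fun _ => h.fth _ _ _⟩ c
  · simp only [map_add, h, h', RightComodule.sw_add]

/-- The heart of the compatibility with $\tau$: `tensFamily_twistMap` at $u_+\otimes u_-$, combined
with `transl_Ψ`. -/
theorem tensFamily_twist (hΩ : IsComoduleMeasuring m ρ M M' Ω) (Φ : m.UFamily V V') (y : D)
    (u : U) (z : (H.tens V M.lmod).carrier) :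
    (tensFamily Φ hΩ.family).toLin y (M.twist V u z) =
      ρ.sw y (fun d c => M'.twist V' (m.Ψ c u) ((tensFamily Φ hΩ.family).toLin d z)) := by
  refine H.tm_induction (p := fun z => (tensFamily Φ hΩ.family).toLin y (M.twist V u z) =
      ρ.sw y (fun d c => M'.twist V' (m.Ψ c u) ((tensFamily Φ hΩ.family).toLin d z)))
    ?_ (fun x p => ?_) (fun z z' h h' => ?_) z
  · simp only [map_zero, RightComodule.sw_zero]
  · have h1 : ∀ c d c', M'.twist V' (m.Ψ c u) (H'.tm V' M'.lmod (Φ.toLin c' x) (Ω d p)) =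
      M'.twistMap V' (Φ.toLin c' x) (Ω d p) (m.opMap c (H.transl u)) := fun c d c' => by
      rw [PreAYD.twist_tm, transl_Ψ]
    rw [PreAYD.twist_tm, hΩ.tensFamily_twistMap]
    refine ρ.sw_congr fun d c => ?_
    rw [tensFamily_family_tm, RightComodule.map_sw]
    exact ρ.sw_congr fun d' c' => (h1 c d' c').symm
  · simp only [map_add, h, h', RightComodule.sw_add]

theorem cochainFamily_cyc (hΩ : IsComoduleMeasuring m ρ M M' Ω) (y : D) : (n : ℕ) →
    (z : (H.cochain M.lmod n).carrier) →
    (cochainFamily hΩ.family n).toLin y (M.cyc n z) =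
      M'.cyc n ((cochainFamily hΩ.family n).toLin y z)
  | 0, _ => rfl
  | n + 1, z => by
    refine LinearMap.congr_fun (f := ((cochainFamily hΩ.family (n + 1)).toLin y).comp
      (M.cyc (n + 1))) (g := (M'.cyc (n + 1)).comp ((cochainFamily hΩ.family (n + 1)).toLin y))
      (H.ut_ext fun u c => ?_) z
    have h1 : M.cyc (n + 1) (H.ut _ u c) = (H.join M.lmod n).toLin
        (M.twist (H.pow n) u ((H.split M.lmod n).toLin ((M.coface n n).toLin c))) :=
      H.liftU_ut _ _ u c
    have h2 : ∀ u c, M'.cyc (n + 1) (H'.ut _ u c) = (H'.join M'.lmod n).toLin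
        (M'.twist (H'.pow n) u ((H'.split M'.lmod n).toLin ((M'.coface n n).toLin c))) :=
      fun u c => H'.liftU_ut _ _ u c
    have h3 : (cochainFamily hΩ.family (n + 1)).toLin y (H.ut _ u c) =
      ρ.sw y (fun d c' => H'.ut _ (m.Ψ c' u) ((cochainFamily hΩ.family n).toLin d c)) :=
      tenFamily_ut (cochainFamily hΩ.family n) y u c
    refine (congrArg ((cochainFamily hΩ.family (n + 1)).toLin y) h1).trans
      (Eq.trans ?_ (congrArg (M'.cyc (n + 1)) h3).symm)
    refine (intertwines_join hΩ.family n y _).trans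
      (Eq.trans ?_ (ρ.map_sw (M'.cyc (n + 1)) y _).symm)
    refine (congrArg (H'.join M'.lmod n).toLin (hΩ.tensFamily_twist _ y u _)).trans
      ((ρ.map_sw _ y _).trans (ρ.sw_congr fun d c' => ?_))
    refine Eq.trans ?_ (h2 _ _).symm
    -- With `join` and the twist taken care of, the last coface and `split` remain.
    refine congrArg (fun z => (H'.join M'.lmod n).toLin (M'.twist (H'.pow n) (m.Ψ c' u) z)) ?_
    exact (intertwines_split hΩ.family n d _).trans
      (congrArg (H'.split M'.lmod n).toLin (hΩ.intertwines_coface n n d c))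

/-- The morphism of cocyclic modules
`u¹ ⊗ ⋯ ⊗ uⁿ ⊗ p ↦ y₍₁₎(u¹) ⊗ ⋯ ⊗ y₍ₙ₎(uⁿ) ⊗ y₍₀₎(p)`. -/
def cocyclicHom (hΩ : IsComoduleMeasuring m ρ M M' Ω) (y : D) :
    M.cocyclic.Hom M'.cocyclic where
  toFun n := (cochainFamily hΩ.family n).toLin y
  comm_δ := fun n i z => by
    refine Fin.cases ?_ (fun j => ?_) i
    · exact tenFamily_one (cochainFamily hΩ.family n) y z
    · exact hΩ.intertwines_coface n j y z
  comm_σ := fun n i z => intertwines_codeg hΩ.family n i y z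
  comm_τ := fun n z => hΩ.cochainFamily_cyc y n z

end IsComoduleMeasuring

/-! ### The formula on elementary tensors -/

section

variable [Coalgebra.IsCocomm k C]

namespace Measuring

variable {N : LMod.{u} k A} {N' : LMod.{v} k A'}

theorem spread_succ (m : Measuring C H H') (q : N'.carrier) (n : ℕ) (w : Fin (n + 1) → U) (x : C) :
    m.spread N' q (n + 1) w x = (self k C).sw x (fun c₁ c₂ =>
      H'.ut (H'.cochain N' n) (m.Ψ c₁ (w 0)) (m.spread N' q n (fun i => w i.succ) c₂)) :=
  ((self k C).sw_lin _ x).symm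

theorem isLinearMap_spread (m : Measuring C H H') : ∀ (n : ℕ) (w : Fin n → U) (x : C),
    IsLinearMap k (fun q : N'.carrier => m.spread N' q n w x)
  | 0, _, x => ⟨fun p q => smul_add (Coalgebra.counit (R := k) x) (p : N'.carrier) q,
    fun r q => smul_comm (Coalgebra.counit (R := k) x) r (q : N'.carrier)⟩
  | n + 1, w, x => by
    have ih := isLinearMap_spread m n (fun i => w i.succ)
    constructor <;> intros <;>
      simp only [spread_succ, (ih _).map_add, (ih _).map_smul, map_add, map_smul,
        RightComodule.sw_add, RightComodule.sw_smul] <;> rfl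

/-- `spread` hands out the legs from left to right, the recursive families from right to left.
Cocommutativity at each inductive step makes the two agree. -/
theorem cochainFamily_pureTensor (F : m.Family ρ N N') : ∀ (n : ℕ) (w : Fin n → U) (p : N.carrier)
    (y : D), (cochainFamily F n).toLin y (H.pureTensor N n w p) =
      ρ.sw y (fun d c => m.spread N' (F.toLin d p) n w c)
  | 0, _, p, y => (ρ.sw_counit (f := fun d => F.toLin d p)
      (by constructor <;> intros <;> simp) y).symm
  | n + 1, w, p, y => by
    have hs := fun c => isLinearMap_spread (N' := N') m n (fun i => w i.succ) c
    have h : IsTrilin k (fun d c c' => H'.ut (H'.cochain N' n) (m.Ψ c (w 0))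
        (m.spread N' (F.toLin d p) n (fun i => w i.succ) c')) := by
      constructor <;> intros <;> constructor <;> intros <;>
        simp [(hs _).map_add, (hs _).map_smul]
    refine (tenFamily_ut (cochainFamily F n) y (w 0) _).trans ?_
    simp only [cochainFamily_pureTensor F n, RightComodule.map_sw, spread_succ]
    exact (ρ.sw_swap h y).symm.trans (ρ.sw_sw h y)

end Measuring

/-- Elementary tensors span $U^{\otimes_A n}\otimes_A N$; this yields uniqueness of the action of
$y$. -/
theorem HopfAlgebroid.pureTensor_ext (H : HopfAlgebroid k A U) (N : LMod.{u} k A) {Q : Type*}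
    [AddCommGroup Q] [Module k Q] : ∀ (n : ℕ) {f g : (H.cochain N n).carrier →ₗ[k] Q},
    (∀ w p, f (H.pureTensor N n w p) = g (H.pureTensor N n w p)) → f = g
  | 0, _, _, h => LinearMap.ext fun p => h Fin.elim0 p
  | n + 1, f, g, h => H.ut_ext fun u c => by
    refine LinearMap.congr_fun (f := f.comp (H.ut (H.cochain N n) u))
      (g := g.comp (H.ut (H.cochain N n) u)) (pureTensor_ext H N n fun w p => ?_) c
    exact h (Fin.cons u w) p

end

theorem IsComoduleMeasuring.isActionOf_cocyclicHom [Coalgebra.IsCocomm k C]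
    (hΩ : IsComoduleMeasuring m ρ M M' Ω) (y : D) :
    IsActionOf m ρ M M' Ω y (hΩ.cocyclicHom y).toFun := fun n w p l d c e => by
  have hs := fun c => isLinearMap_spread (N' := M'.lmod) m n w c
  refine (cochainFamily_pureTensor hΩ.family n w p y).trans (ρ.sw_eq_sum ?_ e)
  change IsBilin k (fun d c => m.spread M'.lmod (Ω d p) n w c)
  constructor <;> intros <;> constructor <;> intros <;>
    simp [(hs _).map_add, (hs _).map_smul]

theorem IsActionOf.unique {y : D} {Φ Φ' : ∀ n, M.cocyclic.X n →ₗ[k] M'.cocyclic.X n}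
    (h : IsActionOf m ρ M M' Ω y Φ) (h' : IsActionOf m ρ M M' Ω y Φ') : Φ' = Φ := by
  funext n
  refine HopfAlgebroid.pureTensor_ext H M.lmod n fun w p => ?_
  exact (h' n w p _ _ _ (ρ.ρ_eq_sum y)).trans (h n w p _ _ _ (ρ.ρ_eq_sum y)).symm

end Coefficients

/-! ### Induced maps on cohomology -/

section Cohomology

variable {k : Type*} [Field k]

/-- The cohomology is the kernel modulo those coboundaries that lie in it, so commutation with the
differentials is enough and $d\circ d=0$ plays no role. -/
theorem exists_cohomology_map {X : ℕ → Type u} [∀ n, AddCommGroup (X n)] [∀ n, Module k (X n)]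
    {Y : ℕ → Type v} [∀ n, AddCommGroup (Y n)] [∀ n, Module k (Y n)]
    (d : ∀ n, X n →ₗ[k] X (n + 1)) (d' : ∀ n, Y n →ₗ[k] Y (n + 1)) (f : ∀ n, X n →ₗ[k] Y n)
    (hf : ∀ n z, f (n + 1) (d n z) = d' n (f n z)) (n : ℕ) :
    ∃ g : Cohomology d n →ₗ[k] Cohomology d' n, ∀ (z : X n) (hz : d n z = 0),
      ∃ hz' : d' n (f n z) = 0, g (cohClass d z hz) = cohClass d' (f n z) hz' := by
  have hker : ∀ z ∈ LinearMap.ker (d n), f n z ∈ LinearMap.ker (d' n) := fun z hz => by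
    rw [LinearMap.mem_ker] at hz ⊢
    rw [← hf, hz, map_zero]
  refine ⟨Submodule.mapQ _ _ ((f n).restrict hker) ?_, fun z hz => ⟨hker z hz, rfl⟩⟩
  rintro ⟨z, hz⟩ h
  change z ∈ coboundaries d n at h
  change f n z ∈ coboundaries d' n
  -- In degree $0$ the only coboundary is $0$.
  cases n with
  | zero =>
    have h0 : z = 0 := h
    rw [h0, map_zero]
    exact Submodule.zero_mem _
  | succ n =>
    obtain ⟨w, rfl⟩ := h
    exact ⟨f n w, (hf n w).symm⟩

namespace Cocyclic.Hom

variable {E : Cocyclic.{u} k} {F : Cocyclic.{v} k} (Φ : E.Hom F)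

theorem comm_b (n : ℕ) (z : E.X n) : Φ.toFun (n + 1) (E.b n z) = F.b n (Φ.toFun n z) := by
  simp [Cocyclic.b, Φ.comm_δ]

theorem comm_b' (n : ℕ) (z : E.X n) : Φ.toFun (n + 1) (E.b' n z) = F.b' n (Φ.toFun n z) := by
  simp [Cocyclic.b', Φ.comm_δ]

theorem comm_lam (n : ℕ) (z : E.X n) : Φ.toFun n (E.lam n z) = F.lam n (Φ.toFun n z) := by
  simp [Cocyclic.lam, Φ.comm_τ]

theorem comm_lam_pow (n j : ℕ) (z : E.X n) :
    Φ.toFun n ((E.lam n ^ j) z) = (F.lam n ^ j) (Φ.toFun n z) := by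
  induction j with
  | zero => rfl
  | succ j ih => rw [pow_succ', pow_succ', Module.End.mul_apply, Module.End.mul_apply, comm_lam, ih]

theorem comm_nrm (n : ℕ) (z : E.X n) : Φ.toFun n (E.nrm n z) = F.nrm n (Φ.toFun n z) := by
  simp [Cocyclic.nrm, comm_lam_pow]

theorem comm_vert (p q : ℕ) (z : E.X q) :
    Φ.toFun (q + 1) (E.vert p q z) = F.vert p q (Φ.toFun q z) := by
  by_cases h : Even p <;> simp [Cocyclic.vert, h, comm_b, comm_b']

theorem comm_horiz (p q : ℕ) (z : E.X q) :
    Φ.toFun q (E.horiz p q z) = F.horiz p q (Φ.toFun q z) := by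
  by_cases h : Even p <;> simp [Cocyclic.horiz, h, comm_lam, comm_nrm]

/-- The map induced on total complexes. -/
def tot (n : ℕ) : E.Tot n →ₗ[k] F.Tot n :=
  LinearMap.pi fun q => (Φ.toFun q).comp (LinearMap.proj q)

theorem _root_.HopfAlgd.Cocyclic.totD_succ (E : Cocyclic.{u} k) (n : ℕ) (z : E.Tot n)
    (j : Fin (n + 1)) : E.totD n z j.succ = E.vert (n - j) j (z j) +
      (if hj : (j : ℕ) + 1 < n + 1 then
        (E.horiz (n - (j + 1)) (j + 1)).comp (LinearMap.proj (⟨j + 1, hj⟩ : Fin (n + 1)))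
      else 0 : E.Tot n →ₗ[k] E.X (j + 1)) z := rfl

theorem comm_totD (n : ℕ) (z : E.Tot n) : Φ.tot (n + 1) (E.totD n z) = F.totD n (Φ.tot n z) := by
  funext q
  refine Fin.cases ?_ (fun j => ?_) q
  · exact Φ.comm_horiz n 0 (z 0)
  · change Φ.toFun (j + 1) (E.totD n z j.succ) = _
    rw [Cocyclic.totD_succ, Cocyclic.totD_succ, map_add, comm_vert]
    -- For $j=n$ the target entry lies in column $0$ of the bicomplex and receives only a vertical
    -- differential; otherwise a horizontal one is added.
    by_cases hj : (j : ℕ) + 1 < n + 1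
    · simp only [hj, dif_pos, LinearMap.comp_apply, LinearMap.proj_apply, comm_horiz]
      rfl
    · simp only [hj, dif_neg, not_false_eq_true, LinearMap.zero_apply, map_zero]
      rfl

end Cocyclic.Hom

end Cohomology

end HopfAlgd

end

/-! ### The morphism of cocyclic modules and the induced maps on cohomology -/

theorem proposition6p3
    {k A A' : Type*} {U P : Type u} {U' P' : Type v} {C D : Type*}
    [Field k] [Ring A] [Algebra k A] [Ring A'] [Algebra k A']
    [Ring U] [Algebra k U] [Ring U'] [Algebra k U']
    (H : HopfAlgd.HopfAlgebroid k A U) (H' : HopfAlgd.HopfAlgebroid k A' U')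
    [AddCommGroup P] [Module k P] [Module A P] [IsScalarTower k A P]
    [Module Uᵐᵒᵖ P] [IsScalarTower k Uᵐᵒᵖ P]
    [AddCommGroup P'] [Module k P'] [Module A' P'] [IsScalarTower k A' P']
    [Module U'ᵐᵒᵖ P'] [IsScalarTower k U'ᵐᵒᵖ P']
    (M : HopfAlgd.SAYD H P) (M' : HopfAlgd.SAYD H' P')
    [AddCommGroup C] [Module k C] [Coalgebra k C] [Coalgebra.IsCocomm k C]
    [AddCommGroup D] [Module k D] (ρ : HopfAlgd.RightComodule k C D)
    (m : HopfAlgd.Measuring C H H') (Ω : D →ₗ[k] P →ₗ[k] P')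
    (hΩ : HopfAlgd.IsComoduleMeasuring m ρ M M' Ω) (y : D) :
    -- the action of `y` is a well-defined morphism of cocyclic modules
    ∃ Φ : M.cocyclic.Hom M'.cocyclic,
      HopfAlgd.IsActionOf m ρ M M' Ω y Φ.toFun ∧
      (∀ Φ' : ∀ n, M.cocyclic.X n →ₗ[k] M'.cocyclic.X n,
        HopfAlgd.IsActionOf m ρ M M' Ω y Φ' → Φ' = Φ.toFun) ∧
      -- it induces maps on Hochschild cohomology
      (∀ n, ∃ g : M.cocyclic.HH n →ₗ[k] M'.cocyclic.HH n,
        ∀ (z : M.cocyclic.X n) (hz : M.cocyclic.b n z = 0),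
          ∃ hz' : M'.cocyclic.b n (Φ.toFun n z) = 0,
            g (HopfAlgd.cohClass M.cocyclic.b z hz) =
              HopfAlgd.cohClass M'.cocyclic.b (Φ.toFun n z) hz') ∧
      -- it induces maps on cyclic cohomology
      (∀ n, ∃ g : M.cocyclic.HC n →ₗ[k] M'.cocyclic.HC n,
        ∀ (z : M.cocyclic.Tot n) (hz : M.cocyclic.totD n z = 0),
          ∃ hz' : M'.cocyclic.totD n (fun q => Φ.toFun q (z q)) = 0,
            g (HopfAlgd.cohClass M.cocyclic.totD z hz) =
              HopfAlgd.cohClass M'.cocyclic.totD (fun q => Φ.toFun q (z q)) hz') :=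
  ⟨hΩ.cocyclicHom y, hΩ.isActionOf_cocyclicHom y,
    fun _ h => (hΩ.isActionOf_cocyclicHom y).unique h,
    HopfAlgd.exists_cohomology_map _ _ _ (hΩ.cocyclicHom y).comm_b,
    HopfAlgd.exists_cohomology_map _ _ (hΩ.cocyclicHom y).tot (hΩ.cocyclicHom y).comm_totD⟩
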